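/- Let $J$ be a semi-infinite real symmetric Jacobi matrix with diagonal entries $b_1,b_2,\dots\in\mathbb{R}$ and off-diagonal entries $a_1,a_2,\dots>0$, and put $a_0=1$. Assume that $$\sum_{n\ge 1} n\Bigl(\bigl|a_n-\tfrac12\bigr|+|b_n|\Bigr)<\infty .$$ Let $f_n(z)$, $n\ge 0$, be the Jost solution, i.e. the solution of $$a_{n-1}f_{n-1}(z)+b_nf_n(z)+a_nf_{n+1}(z)=\tfrac12(z+z^{-1})f_n(z),\qquad n\ge 1,\ 0<|z|\le 1,$$ such that $f_n(z)z^{-n}\to 1$ as $n\to\infty$, uniformly in $0<|z|\le 1$. Assume that $J$, as an operator in $\ell^2$, has no discrete spectrum (no eigenvalues of finite algebraic multiplicity outside $[-1,1]$) and no resonance ($f_0(1)\ne 0$ and $f_0(-1)\neq 0$). Let $S(\zeta)=\overline{f_0(\zeta)}/f_0(\zeta)$, $|\zeta|=1$, be the scattering function, and put $$F(n)=-\frac1{2\pi}\int_{-\pi}^{\pi}S(e^{i\theta})e^{in\theta}\,d\theta,\qquad \hat F(n)=\sum_{j=0}^\infty|F(n+j)-F(n+j+2)| .$$ If $\sum_{n=1}^\infty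 n\,|F(n+2)-F(n)|<\infty$, then there is a constant $C$, depending only on $J$, such that for all $n\ge 1$ $$|2a_n-1|+|b_n|\le C\bigl\{|F(2n-1)-F(2n+1)|+|F(2n)-F(2n+2)|+\hat F(2n-2)^2\bigr\}.$$ -/

import Mathlib

/-- A bounded real symmetric semi-infinite Jacobi matrix with diagonal entries `b 1, b 2, …` and
off-diagonal entries `a 1, a 2, … > 0`.  The normalization `a 0 = 1` is the convention that is used
when the three-term recurrence is extended down to the index `0`; the value `b 0` is never used. -/
structure JacobiMatrix where
  a : ℕ → ℝ
  b : ℕ → ℝ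
  a_zero : a 0 = 1
  a_pos : ∀ n, 0 < a n
  bdd : ∃ M : ℝ, ∀ n, |a n| ≤ M ∧ |b n| ≤ M

namespace JacobiMatrix

/-- The `k`-th entry (`k = 0, 1, …`) of the product of the matrix with the column `y`. -/
noncomputable def entry (J : JacobiMatrix) (y : ℕ → ℂ) : ℕ → ℂ
  | 0 => (J.b 1 : ℂ) * y 0 + (J.a 1 : ℂ) * y 1
  | k + 1 => (J.a (k + 1) : ℂ) * y k + (J.b (k + 2) : ℂ) * y (k + 1) +
      (J.a (k + 2) : ℂ) * y (k + 2)

theorem memlp_entry (J : JacobiMatrix) {y : ℕ → ℂ} (hy : Memℓp y 2) :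
    Memℓp (J.entry y) 2 := by
  obtain ⟨M, hM⟩ := J.bdd
  have h2 : (0 : ℝ) < (2 : ENNReal).toReal := by norm_num
  have hs : Summable fun k => ‖y k‖ ^ (2 : ℝ) := by
    simpa using (memℓp_gen_iff h2).1 hy
  have hshift : ∀ i, Summable fun k => ‖y (k + i)‖ ^ (2 : ℝ) := fun i =>
    (summable_nat_add_iff i).2 hs
  refine (memℓp_gen_iff h2).2 ?_
  rw [← summable_nat_add_iff 1]
  refine Summable.of_nonneg_of_le (fun k => by positivity) (fun k => ?_)
    ((((hshift 0).add (hshift 1)).add (hshift 2)).mul_left (3 * M ^ 2))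
  have hA := (hM (k + 1)).1
  have hB := (hM (k + 2)).2
  have hD := (hM (k + 2)).1
  have hM0 : 0 ≤ M := (abs_nonneg _).trans hA
  have key : ‖J.entry y (k + 1)‖ ≤ M * (‖y k‖ + ‖y (k + 1)‖ + ‖y (k + 2)‖) := by
    refine (norm_add₃_le).trans ?_
    simp only [norm_mul, Complex.norm_real, Real.norm_eq_abs]
    have e1 := mul_le_mul_of_nonneg_right hA (norm_nonneg (y k))
    have e2 := mul_le_mul_of_nonneg_right hB (norm_nonneg (y (k + 1)))
    have e3 := mul_le_mul_of_nonneg_right hD (norm_nonneg (y (k + 2)))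
    linarith
  simp only [ENNReal.toReal_ofNat, Real.rpow_two, add_zero]
  calc ‖J.entry y (k + 1)‖ ^ 2
      ≤ (M * (‖y k‖ + ‖y (k + 1)‖ + ‖y (k + 2)‖)) ^ 2 := by gcongr
    _ = M ^ 2 * (‖y k‖ + ‖y (k + 1)‖ + ‖y (k + 2)‖) ^ 2 := by ring
    _ ≤ M ^ 2 * (3 * (‖y k‖ ^ 2 + ‖y (k + 1)‖ ^ 2 + ‖y (k + 2)‖ ^ 2)) := by
        gcongr
        nlinarith [sq_nonneg (‖y k‖ - ‖y (k + 1)‖), sq_nonneg (‖y k‖ - ‖y (k + 2)‖),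
          sq_nonneg (‖y (k + 1)‖ - ‖y (k + 2)‖)]
    _ = _ := by ring

/-- The operator generated by the Jacobi matrix in the Hilbert space `ℓ²`. -/
noncomputable def operator (J : JacobiMatrix) :
    Module.End ℂ (lp (fun _ : ℕ => ℂ) 2) where
  toFun y := ⟨J.entry y, J.memlp_entry y.2⟩
  map_add' x y := by
    ext k
    change J.entry (x + y : lp (fun _ : ℕ => ℂ) 2) k = J.entry x k + J.entry y k
    cases k <;> simp [entry] <;> ring
  map_smul' c x := by
    ext k
    change J.entry (c • x : lp (fun _ : ℕ => ℂ) 2) k = c * J.entry x k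
    cases k <;> simp [entry] <;> ring

/-- The discrete spectrum: the eigenvalues of finite algebraic multiplicity outside `[-1, 1]`,
the latter being the essential spectrum when `a n → 1/2` and `b n → 0`. -/
def discreteSpectrum (J : JacobiMatrix) : Set ℂ :=
  {μ | μ ∉ ((↑) : ℝ → ℂ) '' Set.Icc (-1) 1 ∧ J.operator.HasEigenvalue μ ∧
    FiniteDimensional ℂ (J.operator.maxGenEigenspace μ)}

/-- Finiteness of the first moment of the perturbation of the free matrix. -/
def HasFiniteFirstMoment (J : JacobiMatrix) : Prop :=
  Summable fun n : ℕ => (n : ℝ) * (|J.a n - 1 / 2| + |J.b n|)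

/-- `f n z` is a Jost solution: for every `z ≠ 0` of the closed unit disk it solves the three-term
recurrence with spectral parameter `(z + z⁻¹) / 2`, and `f n z * z ^ (-n) → 1` uniformly
in these `z`.  (This determines `f n z` for all such `z` if the first moment is finite;
the values at `z = 0` play no role.) -/
def IsJostSolution (J : JacobiMatrix) (f : ℕ → ℂ → ℂ) : Prop :=
  (∀ z : ℂ, z ≠ 0 → ‖z‖ ≤ 1 → ∀ n : ℕ,
    (J.a n : ℂ) * f n z + (J.b (n + 1) : ℂ) * f (n + 1) z + (J.a (n + 1) : ℂ) * f (n + 2) z =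
      (z + z⁻¹) / 2 * f (n + 1) z) ∧
  TendstoUniformlyOn (fun (n : ℕ) (z : ℂ) => f n z * (z ^ n)⁻¹) (fun _ => 1) Filter.atTop
    {z : ℂ | z ≠ 0 ∧ ‖z‖ ≤ 1}

/-- The Jost solution. -/
noncomputable def jostSolution (J : JacobiMatrix) : ℕ → ℂ → ℂ :=
  Classical.epsilon J.IsJostSolution

/-- The Jost function `f₀`. -/
noncomputable def jostFunction (J : JacobiMatrix) : ℂ → ℂ := J.jostSolution 0

/-- Absence of resonance: the Jost function does not vanish at `1` and `-1`. -/
def NoResonance (J : JacobiMatrix) : Prop :=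
  J.jostFunction 1 ≠ 0 ∧ J.jostFunction (-1) ≠ 0

/-- The scattering function on the unit circle. -/
noncomputable def scatteringFunction (J : JacobiMatrix) (ζ : ℂ) : ℂ :=
  (starRingEnd ℂ) (J.jostFunction ζ) / J.jostFunction ζ

/-- The coefficients `F n = -(1 / 2π) ∫_{-π}^{π} S(e^{iθ}) e^{inθ} dθ`. -/
noncomputable def scatteringCoeff (J : JacobiMatrix) (n : ℤ) : ℂ :=
  -(1 / (2 * (Real.pi : ℂ))) * ∫ θ in (-Real.pi)..Real.pi,
    J.scatteringFunction (Complex.exp (θ * Complex.I)) * Complex.exp (n * θ * Complex.I)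

/-- The tail sums `∑_{j ≥ 0} |F (n + j) - F (n + j + 2)|`. -/
noncomputable def tailSum (J : JacobiMatrix) (n : ℤ) : ℝ :=
  ∑' j : ℕ, ‖J.scatteringCoeff (n + j) - J.scatteringCoeff (n + j + 2)‖

end JacobiMatrix

/-! ### Summability, increment tails and Hankel sums -/

section Sequences

/-! The Jost solution factors as `f n z = z ^ n * G n z / A n`, where `A n` is the product of `2 * a
j` over `j ≥ n` and `G n` is a power series with absolutely summable real coefficients `g n`, `g n 0
= 1` (`nonempty_jostKernel`). The Jacobi parameters are increments of these data: `2 * b (n + 1) = g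
(n + 1) 1 - g n 1` and `A n = 2 * a n * A (n + 1)`.

On the unit circle the Wronskian of `f n` with `conj (f 0)` gives `scattering_relation`. Without
discrete spectrum and resonances `G 0` has no zero in the closed disk (`G_zero_ne_zero`), so one
side of the relation is analytic there and its Fourier modes are known. Comparing modes gives the
Marchenko equations (`marchenko_average`): a linear Hankel equation for the off-diagonal kernel `k
n`, and a formula for `A n ^ 2`.

The hypothesis on `F` makes `F` summable and dominated by its increment tail `T`. Once the ℓ¹ tail
of `F` from `2 * n` is at most 1/2, the Hankel operator is a contraction, so `k n` has ℓ¹ norm at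
most 1, while its sup norm and the ℓ¹ norm of `k n - k (n + 1)` are `O(T (2 * n))`. Differencing the
Marchenko equations in `n` leaves one explicit increment of `F` plus products of two small
quantities, hence `O(T ^ 2)` (`norm_kernel_zero_sub_le`, `norm_marchenkoDiag_sub_le`).
`exists_bound_of_marchenkoEq` turns this into the bound and absorbs the finitely many small indices
into the constant. -/

theorem summable_of_summable_nat_mul {u : ℕ → ℝ} (hu : ∀ n, 0 ≤ u n)
    (h : Summable fun n : ℕ => (n : ℝ) * u n) : Summable u := by
  rw [← summable_nat_add_iff 1] at h ⊢
  refine Summable.of_nonneg_of_le (fun n => hu _) (fun n => ?_) h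
  have := hu (n + 1)
  push_cast
  nlinarith [(Nat.cast_nonneg n : (0 : ℝ) ≤ n)]

/-- Summation by parts: `u m` occurs in the tails starting at `0, …, m`, that is, `m + 1` times. -/
theorem summable_tails {u : ℕ → ℝ} (hu : ∀ n, 0 ≤ u n)
    (h : Summable fun n : ℕ => (n : ℝ) * u n) :
    Summable fun n : ℕ => ∑' j, u (n + j) := by
  have hs := summable_of_summable_nat_mul hu h
  have hs' : ∀ n, Summable fun j => u (n + j) := fun n => by
    simpa [add_comm] using (summable_nat_add_iff n).2 hs
  have hstep : ∀ n, ∑' j, u (n + j) = u n + ∑' j, u (n + 1 + j) := fun n => by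
    rw [(hs' n).tsum_eq_zero_add, add_zero]
    congr 2
    ext j
    rw [show n + (j + 1) = n + 1 + j by ring]
  have htot : Summable fun n : ℕ => ((n : ℝ) + 1) * u n := by
    simpa [add_mul] using h.add hs
  have hT : ∀ n : ℕ, (n : ℝ) * ∑' j, u (n + j) ≤ ∑' j, (((n + j : ℕ) : ℝ) + 1) * u (n + j) := fun n => by
    rw [← tsum_mul_left]
    refine Summable.tsum_le_tsum (fun j => ?_) ((hs' n).mul_left _) ?_
    · refine mul_le_mul_of_nonneg_right ?_ (hu _)
      push_cast
      have : (0 : ℝ) ≤ j := Nat.cast_nonneg j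
      linarith
    · have := (summable_nat_add_iff n).2 htot
      simpa [add_comm] using this
  refine summable_of_sum_range_le (c := ∑' n : ℕ, ((n : ℝ) + 1) * u n)
    (fun n => tsum_nonneg fun j => hu _) (fun N => ?_)
  have key : ∀ N : ℕ, ∑ n ∈ Finset.range N, ∑' j, u (n + j) =
      ∑ n ∈ Finset.range N, ((n : ℝ) + 1) * u n + N * ∑' j, u (N + j) := by
    intro N
    induction N with
    | zero => simp
    | succ N ih =>
      rw [Finset.sum_range_succ, Finset.sum_range_succ, ih, hstep N]
      push_cast
      ring
  rw [key, ← htot.sum_add_tsum_nat_add N]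
  refine add_le_add le_rfl ((hT N).trans (le_of_eq ?_))
  congr 1
  ext j
  simp [add_comm]

/-- The tail sums of the second-order increments. -/
noncomputable def incrementTail (F : ℕ → ℂ) (n : ℕ) : ℝ :=
  ∑' j : ℕ, ‖F (n + j) - F (n + j + 2)‖

theorem summable_shift {u : ℕ → ℝ} (hu : Summable u) (n : ℕ) : Summable fun j => u (n + j) := by
  simpa [add_comm] using (summable_nat_add_iff n).2 hu

theorem tsum_shift_le {u : ℕ → ℝ} (hu0 : ∀ n, 0 ≤ u n) (hu : Summable u) {m n : ℕ} (h : n ≤ m) :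
    ∑' j, u (m + j) ≤ ∑' j, u (n + j) := by
  obtain ⟨i, rfl⟩ := Nat.exists_eq_add_of_le h
  rw [← (summable_shift hu n).sum_add_tsum_nat_add i]
  have : ∀ j, u (n + i + j) = u (n + (j + i)) := fun j => by congr 1; ring
  simp only [this]
  have := Finset.sum_nonneg (s := Finset.range i) (f := fun j => u (n + j)) fun j _ => hu0 _
  linarith

theorem incrementTail_nonneg (F : ℕ → ℂ) (n : ℕ) : 0 ≤ incrementTail F n :=
  tsum_nonneg fun _ => norm_nonneg _

theorem incrementTail_anti {F : ℕ → ℂ} (hd : Summable fun n => ‖F n - F (n + 2)‖) {m n : ℕ}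
    (h : n ≤ m) : incrementTail F m ≤ incrementTail F n :=
  tsum_shift_le (u := fun n => ‖F n - F (n + 2)‖) (fun _ => norm_nonneg _) hd h

/-- Telescope in steps of two towards the limit 0. Only even `j` are used; the odd terms of the tail
are added for free. -/
theorem norm_le_incrementTail {F : ℕ → ℂ} (hd : Summable fun n => ‖F n - F (n + 2)‖)
    (h0 : Filter.Tendsto F Filter.atTop (nhds 0)) (n : ℕ) : ‖F n‖ ≤ incrementTail F n := by
  have key : ∀ N : ℕ, ‖F n‖ ≤ ‖F (n + 2 * N)‖ +
      ∑ j ∈ Finset.range (2 * N), ‖F (n + j) - F (n + j + 2)‖ := by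
    intro N
    induction N with
    | zero => simp
    | succ N ih =>
      rw [show 2 * (N + 1) = 2 * N + 1 + 1 by ring, Finset.sum_range_succ, Finset.sum_range_succ]
      have h1 := norm_le_norm_add_norm_sub' (F (n + 2 * N)) (F (n + 2 * N + 2))
      have h2 := norm_nonneg (F (n + (2 * N + 1)) - F (n + (2 * N + 1) + 2))
      rw [show n + (2 * N + 1 + 1) = n + 2 * N + 2 by ring]
      linarith
  have hlim : Filter.Tendsto (fun N : ℕ => ‖F (n + 2 * N)‖ + incrementTail F n) Filter.atTop
      (nhds (0 + incrementTail F n)) := by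
    refine Filter.Tendsto.add_const _ ?_
    have : Filter.Tendsto (fun N : ℕ => n + 2 * N) Filter.atTop Filter.atTop :=
      Filter.tendsto_atTop_mono (fun N => by simp only [id]; omega) Filter.tendsto_id
    simpa using (h0.comp this).norm
  rw [zero_add] at hlim
  refine ge_of_tendsto' hlim fun N => (key N).trans ?_
  have := (summable_shift hd n).sum_le_tsum (Finset.range (2 * N)) fun _ _ => norm_nonneg _
  exact add_le_add le_rfl this

theorem norm_le_incrementTail_of_le {F : ℕ → ℂ} (hd : Summable fun n => ‖F n - F (n + 2)‖)
    (h0 : Filter.Tendsto F Filter.atTop (nhds 0)) {m n : ℕ} (h : n ≤ m) :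
    ‖F m‖ ≤ incrementTail F n :=
  (norm_le_incrementTail hd h0 m).trans (incrementTail_anti hd h)

theorem summable_mul_of_summable_norm_shift {u k : ℕ → ℂ} (hu : Summable fun n => ‖u n‖)
    (hk : Summable fun n => ‖k n‖) (p : ℕ) : Summable fun l => ‖u (p + l) * k l‖ := by
  obtain ⟨M, hM⟩ : ∃ M, ∀ n, ‖u n‖ ≤ M := ⟨∑' n, ‖u n‖, fun n => hu.le_tsum n fun _ _ => norm_nonneg _⟩
  refine Summable.of_nonneg_of_le (fun _ => norm_nonneg _) (fun l => ?_) (hk.mul_left M)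
  rw [norm_mul]
  exact mul_le_mul_of_nonneg_right (hM _) (norm_nonneg _)

theorem norm_tsum_hankel_le {u k : ℕ → ℂ} (hu : Summable fun n => ‖u n‖)
    (hk : Summable fun n => ‖k n‖) (p : ℕ) {M : ℝ} (hM : ∀ l, ‖u (p + l)‖ ≤ M) :
    ‖∑' l, u (p + l) * k l‖ ≤ M * ∑' l, ‖k l‖ := by
  refine (norm_tsum_le_tsum_norm (summable_mul_of_summable_norm_shift hu hk p)).trans ?_
  rw [← tsum_mul_left]
  refine Summable.tsum_le_tsum (fun l => ?_) (summable_mul_of_summable_norm_shift hu hk p)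
    (hk.mul_left M)
  rw [norm_mul]
  exact mul_le_mul_of_nonneg_right (hM _) (norm_nonneg _)

theorem norm_tsum_hankel_le' {u k : ℕ → ℂ} (hu : Summable fun n => ‖u n‖)
    (hk : Summable fun n => ‖k n‖) (p : ℕ) {M : ℝ} (hM : ∀ l, ‖k l‖ ≤ M) :
    ‖∑' l, u (p + l) * k l‖ ≤ (∑' l, ‖u (p + l)‖) * M := by
  refine (norm_tsum_le_tsum_norm (summable_mul_of_summable_norm_shift hu hk p)).trans ?_
  rw [← tsum_mul_right]
  refine Summable.tsum_le_tsum (fun l => ?_) (summable_mul_of_summable_norm_shift hu hk p)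
    ((summable_shift hu p).mul_right M)
  rw [norm_mul]
  exact mul_le_mul_of_nonneg_left (hM _) (norm_nonneg _)

/-- Exchange the sums: the column with index `l` of the Hankel matrix is a tail of `u` starting at
`p + l`, so its ℓ¹ norm is at most that of the tail from `p`. -/
theorem hankel_l1 {u k : ℕ → ℂ} (hu : Summable fun n => ‖u n‖)
    (hk : Summable fun n => ‖k n‖) (p : ℕ) :
    (Summable fun m => ‖∑' l, u (p + m + l) * k l‖) ∧
      ∑' m, ‖∑' l, u (p + m + l) * k l‖ ≤ (∑' j, ‖u (p + j)‖) * ∑' l, ‖k l‖ := by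
  have hb : ∀ N, ∑ m ∈ Finset.range N, ‖∑' l, u (p + m + l) * k l‖ ≤
      (∑' j, ‖u (p + j)‖) * ∑' l, ‖k l‖ := by
    intro N
    calc ∑ m ∈ Finset.range N, ‖∑' l, u (p + m + l) * k l‖
        ≤ ∑ m ∈ Finset.range N, ∑' l, ‖u (p + m + l) * k l‖ :=
          Finset.sum_le_sum fun m _ =>
            norm_tsum_le_tsum_norm (summable_mul_of_summable_norm_shift hu hk (p + m))
      _ = ∑' l, ∑ m ∈ Finset.range N, ‖u (p + m + l) * k l‖ :=
          (Summable.tsum_finsetSum fun m _ => summable_mul_of_summable_norm_shift hu hk (p + m)).symm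
      _ ≤ ∑' l, (∑' j, ‖u (p + j)‖) * ‖k l‖ := by
          refine Summable.tsum_le_tsum (fun l => ?_)
            (summable_sum fun m _ => summable_mul_of_summable_norm_shift hu hk (p + m))
            (hk.mul_left _)
          simp only [norm_mul]
          rw [← Finset.sum_mul]
          refine mul_le_mul_of_nonneg_right ?_ (norm_nonneg _)
          refine le_trans ?_ (tsum_shift_le (u := fun n => ‖u n‖) (fun _ => norm_nonneg _) hu
            (show p ≤ p + l by omega))
          refine le_trans (le_of_eq ?_) ((summable_shift hu (p + l)).sum_le_tsum (Finset.range N)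
            fun _ _ => norm_nonneg _)
          refine Finset.sum_congr rfl fun m _ => ?_
          rw [show p + m + l = p + l + m by ring]
      _ = _ := tsum_mul_left
  refine ⟨summable_of_sum_range_le (fun _ => norm_nonneg _) hb,
    Real.tsum_le_of_sum_range_le (fun _ => norm_nonneg _) hb⟩

/-! ### Estimates for the Marchenko equation -/

variable {F : ℕ → ℂ} {k : ℕ → ℕ → ℂ} {n : ℕ}

/-- The off-diagonal Marchenko equation, with `k n l` the normalized kernel at distance `l + 1`
from the diagonal. -/
def MarchenkoEq (F : ℕ → ℂ) (k : ℕ → ℕ → ℂ) : Prop :=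
  ∀ n m, k n m + F (2 * n + m + 1) + ∑' l, F (2 * n + m + 2 + l) * k n l = 0

/-- The left side of the diagonal Marchenko equation. -/
noncomputable def marchenkoDiag (F : ℕ → ℂ) (k : ℕ → ℕ → ℂ) (n : ℕ) : ℂ :=
  1 + F (2 * n) + ∑' l, F (2 * n + 1 + l) * k n l

/-- Taking ℓ¹ norms in the equation gives `x ≤ 1/2 + x/2` for the norm `x` of the kernel. -/
theorem tsum_norm_kernel_le (hF : Summable fun n => ‖F n‖) (hk : Summable fun l => ‖k n l‖)
    (hM : MarchenkoEq F k) (hn : ∑' j, ‖F (2 * n + j)‖ ≤ 1 / 2) : ∑' l, ‖k n l‖ ≤ 1 := by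
  obtain ⟨hs, hle⟩ := hankel_l1 hF hk (2 * n + 2)
  have hs1 := summable_shift hF (2 * n + 1)
  have h : ∑' m, ‖k n m‖ ≤ ∑' m, (‖F (2 * n + 1 + m)‖ +
      ‖∑' l, F (2 * n + 2 + m + l) * k n l‖) := by
    refine Summable.tsum_le_tsum (fun m => ?_) hk (hs1.add hs)
    have := hM n m
    rw [show k n m = -(F (2 * n + 1 + m) + ∑' l, F (2 * n + 2 + m + l) * k n l) by
      rw [show 2 * n + 1 + m = 2 * n + m + 1 by ring, show 2 * n + 2 + m = 2 * n + m + 2 by ring]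
      linear_combination this, norm_neg]
    exact norm_add_le _ _
  rw [hs1.tsum_add hs] at h
  have h1 := tsum_shift_le (u := fun n => ‖F n‖) (fun _ => norm_nonneg _) hF
    (show 2 * n ≤ 2 * n + 1 by omega)
  have h2 := tsum_shift_le (u := fun n => ‖F n‖) (fun _ => norm_nonneg _) hF
    (show 2 * n ≤ 2 * n + 2 by omega)
  have h3 : 0 ≤ ∑' l, ‖k n l‖ := tsum_nonneg fun _ => norm_nonneg _
  nlinarith

theorem norm_kernel_le (hd : Summable fun n => ‖F n - F (n + 2)‖)
    (hF : Summable fun n => ‖F n‖) (hk : Summable fun l => ‖k n l‖)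
    (hM : MarchenkoEq F k) (m : ℕ) :
    ‖k n m‖ ≤ incrementTail F (2 * n) * (1 + ∑' l, ‖k n l‖) := by
  have h0 : Filter.Tendsto F Filter.atTop (nhds 0) :=
    tendsto_zero_iff_norm_tendsto_zero.2 hF.tendsto_atTop_zero
  rw [show k n m = -(F (2 * n + m + 1) + ∑' l, F (2 * n + m + 2 + l) * k n l) by
    linear_combination hM n m, norm_neg, mul_add, mul_one]
  refine (norm_add_le _ _).trans (add_le_add (norm_le_incrementTail_of_le hd h0 (by omega)) ?_)
  exact norm_tsum_hankel_le hF hk _ fun l => norm_le_incrementTail_of_le hd h0 (by omega)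

/-- Discrete product rule. The shift is by 2 because passing from `n` to `n + 1` moves the arguments
of `F` in the Marchenko equation by 2. -/
theorem tsum_hankel_sub (hF : Summable fun n => ‖F n‖) {k₁ k₂ : ℕ → ℂ}
    (h₁ : Summable fun l => ‖k₁ l‖) (h₂ : Summable fun l => ‖k₂ l‖) (p : ℕ) :
    ∑' l, F (p + l) * k₁ l - ∑' l, F (p + 2 + l) * k₂ l =
      ∑' l, (F (p + l) - F (p + l + 2)) * k₁ l + ∑' l, F (p + 2 + l) * (k₁ l - k₂ l) := by
  have s1 := (summable_mul_of_summable_norm_shift hF h₁ p).of_norm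
  have s2 := (summable_mul_of_summable_norm_shift hF h₁ (p + 2)).of_norm
  have s3 := (summable_mul_of_summable_norm_shift hF h₂ (p + 2)).of_norm
  have e1 : ∀ l, (F (p + l) - F (p + l + 2)) * k₁ l = F (p + l) * k₁ l - F (p + 2 + l) * k₁ l :=
    fun l => by rw [show p + l + 2 = p + 2 + l by ring]; ring
  simp only [e1, mul_sub]
  rw [s1.tsum_sub s2, s2.tsum_sub s3]
  ring

theorem kernel_sub_eq (hF : Summable fun n => ‖F n‖) (hk : ∀ n, Summable fun l => ‖k n l‖)
    (hM : MarchenkoEq F k) (n m : ℕ) :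
    k n m - k (n + 1) m = -((F (2 * n + m + 1) - F (2 * n + m + 1 + 2)) +
      ∑' l, (F (2 * n + m + 2 + l) - F (2 * n + m + 2 + l + 2)) * k n l +
      ∑' l, F (2 * n + m + 4 + l) * (k n l - k (n + 1) l)) := by
  have h := tsum_hankel_sub hF (hk n) (hk (n + 1)) (2 * n + m + 2)
  have h1 := hM n m
  have h2 := hM (n + 1) m
  rw [show 2 * (n + 1) + m + 1 = 2 * n + m + 1 + 2 by ring,
    show 2 * (n + 1) + m + 2 = 2 * n + m + 2 + 2 by ring] at h2
  rw [show 2 * n + m + 4 = 2 * n + m + 2 + 2 by ring]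
  linear_combination h1 - h2 - h

/-- The differenced equation has the same contracting Hankel structure, with source of ℓ¹ norm at
most `2 T`: thus `x ≤ 2 T + x/2`. -/
theorem tsum_norm_kernel_sub_le (hd : Summable fun n => ‖F n - F (n + 2)‖)
    (hF : Summable fun n => ‖F n‖) (hk : ∀ n, Summable fun l => ‖k n l‖)
    (hM : MarchenkoEq F k) (hn : ∑' j, ‖F (2 * n + j)‖ ≤ 1 / 2) :
    (Summable fun m => ‖k n m - k (n + 1) m‖) ∧
    ∑' m, ‖k n m - k (n + 1) m‖ ≤ 4 * incrementTail F (2 * n) := by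
  have hdk : Summable fun m => ‖k n m - k (n + 1) m‖ :=
    Summable.of_nonneg_of_le (fun _ => norm_nonneg _) (fun _ => norm_sub_le _ _)
      ((hk n).add (hk (n + 1)))
  refine ⟨hdk, ?_⟩
  obtain ⟨s1, b1⟩ := hankel_l1 hF hdk (2 * n + 4)
  obtain ⟨s2, b2⟩ := hankel_l1 (u := fun n => F n - F (n + 2)) hd (hk n) (2 * n + 2)
  have s0 := summable_shift hd (2 * n + 1)
  have h : ∑' m, ‖k n m - k (n + 1) m‖ ≤ ∑' m, (‖F (2 * n + 1 + m) - F (2 * n + 1 + m + 2)‖ +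
      ‖∑' l, (F (2 * n + 2 + m + l) - F (2 * n + 2 + m + l + 2)) * k n l‖ +
      ‖∑' l, F (2 * n + 4 + m + l) * (k n l - k (n + 1) l)‖) := by
    refine Summable.tsum_le_tsum (fun m => ?_) hdk ((s0.add s2).add s1)
    rw [kernel_sub_eq hF hk hM, norm_neg, show 2 * n + 1 + m = 2 * n + m + 1 by ring,
      show 2 * n + 2 + m = 2 * n + m + 2 by ring, show 2 * n + 4 + m = 2 * n + m + 4 by ring]
    exact norm_add₃_le
  rw [(s0.add s2).tsum_add s1, s0.tsum_add s2] at h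
  have t0 : ∑' m, ‖F (2 * n + 1 + m) - F (2 * n + 1 + m + 2)‖ ≤ incrementTail F (2 * n) :=
    incrementTail_anti hd (show 2 * n ≤ 2 * n + 1 by omega)
  have t2 : ∑' m, ‖F (2 * n + 2 + m) - F (2 * n + 2 + m + 2)‖ ≤ incrementTail F (2 * n) :=
    incrementTail_anti hd (show 2 * n ≤ 2 * n + 2 by omega)
  have t1 := tsum_shift_le (u := fun n => ‖F n‖) (fun _ => norm_nonneg _) hF
    (show 2 * n ≤ 2 * n + 4 by omega)
  have hk1 := tsum_norm_kernel_le hF (hk n) hM hn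
  have hk0 : 0 ≤ ∑' l, ‖k n l‖ := tsum_nonneg fun _ => norm_nonneg _
  have hd0 : 0 ≤ ∑' m, ‖k n m - k (n + 1) m‖ := tsum_nonneg fun _ => norm_nonneg _
  have hT := incrementTail_nonneg F (2 * n)
  have c1 := mul_le_mul_of_nonneg_right (t1.trans hn) hd0
  have c2 := mul_le_mul t2 hk1 hk0 hT
  linarith

/-- Each product is quadratic in `T = incrementTail F (2 * n)`. The first pairs the ℓ¹ norm of the
increments (`T`) with the sup of the kernel (`2 T`); the second pairs the sup of `F` (`T`) with the
ℓ¹ norm of the kernel difference (`4 T`). -/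
theorem norm_hankel_sub_le (hd : Summable fun n => ‖F n - F (n + 2)‖)
    (hF : Summable fun n => ‖F n‖) (hk : ∀ n, Summable fun l => ‖k n l‖)
    (hM : MarchenkoEq F k) (hn : ∑' j, ‖F (2 * n + j)‖ ≤ 1 / 2) {p q : ℕ} (hp : 2 * n ≤ p)
    (hq : 2 * n ≤ q) :
    ‖∑' l, (F (p + l) - F (p + l + 2)) * k n l + ∑' l, F (q + l) * (k n l - k (n + 1) l)‖ ≤
      6 * incrementTail F (2 * n) ^ 2 := by
  have h0 : Filter.Tendsto F Filter.atTop (nhds 0) :=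
    tendsto_zero_iff_norm_tendsto_zero.2 hF.tendsto_atTop_zero
  have hT := incrementTail_nonneg F (2 * n)
  have hk1 := tsum_norm_kernel_le hF (hk n) hM hn
  obtain ⟨sd, bd⟩ := tsum_norm_kernel_sub_le hd hF hk hM hn
  have hkm : ∀ m, ‖k n m‖ ≤ 2 * incrementTail F (2 * n) := fun m => by
    have := norm_kernel_le hd hF (hk n) hM m
    nlinarith
  have e1 := norm_tsum_hankel_le' (u := fun n => F n - F (n + 2)) hd (hk n) p hkm
  have e2 := norm_tsum_hankel_le hF sd q
    (fun l => norm_le_incrementTail_of_le hd h0 (show 2 * n ≤ q + l by omega))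
  have e3 : ∑' l, ‖F (p + l) - F (p + l + 2)‖ ≤ incrementTail F (2 * n) := incrementTail_anti hd hp
  refine (norm_add_le _ _).trans ((add_le_add e1 e2).trans ?_)
  have c1 := mul_le_mul_of_nonneg_right e3 (show 0 ≤ 2 * incrementTail F (2 * n) by linarith)
  have c2 := mul_le_mul_of_nonneg_left bd hT
  nlinarith

theorem norm_kernel_zero_sub_le (hd : Summable fun n => ‖F n - F (n + 2)‖)
    (hF : Summable fun n => ‖F n‖) (hk : ∀ n, Summable fun l => ‖k n l‖)
    (hM : MarchenkoEq F k) (hn : ∑' j, ‖F (2 * n + j)‖ ≤ 1 / 2) :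
    ‖k n 0 - k (n + 1) 0‖ ≤
      ‖F (2 * n + 1) - F (2 * n + 3)‖ + 6 * incrementTail F (2 * n) ^ 2 := by
  rw [kernel_sub_eq hF hk hM, norm_neg, add_assoc]
  refine (norm_add_le _ _).trans (add_le_add le_rfl ?_)
  exact norm_hankel_sub_le hd hF hk hM hn (by omega) (by omega)

theorem norm_marchenkoDiag_sub_le (hd : Summable fun n => ‖F n - F (n + 2)‖)
    (hF : Summable fun n => ‖F n‖) (hk : ∀ n, Summable fun l => ‖k n l‖)
    (hM : MarchenkoEq F k) (hn : ∑' j, ‖F (2 * n + j)‖ ≤ 1 / 2) :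
    ‖marchenkoDiag F k n - marchenkoDiag F k (n + 1)‖ ≤
      ‖F (2 * n) - F (2 * n + 2)‖ + 6 * incrementTail F (2 * n) ^ 2 := by
  have h := tsum_hankel_sub hF (hk n) (hk (n + 1)) (2 * n + 1)
  have e : marchenkoDiag F k n - marchenkoDiag F k (n + 1) = (F (2 * n) - F (2 * n + 2)) +
      (∑' l, (F (2 * n + 1 + l) - F (2 * n + 1 + l + 2)) * k n l +
        ∑' l, F (2 * n + 1 + 2 + l) * (k n l - k (n + 1) l)) := by
    rw [← h, marchenkoDiag, marchenkoDiag, show 2 * (n + 1) = 2 * n + 2 by ring,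
      show 2 * n + 2 + 1 = 2 * n + 1 + 2 by ring]
    ring
  rw [e]
  refine (norm_add_le _ _).trans (add_le_add le_rfl ?_)
  exact norm_hankel_sub_le hd hF hk hM hn (by omega) (by omega)

theorem eq_zero_of_incrementTail_eq_zero (hd : Summable fun n => ‖F n - F (n + 2)‖)
    (h0 : Filter.Tendsto F Filter.atTop (nhds 0)) {p : ℕ} (hp : incrementTail F p = 0) {m : ℕ}
    (hm : p ≤ m) : F m = 0 :=
  norm_le_zero_iff.1 ((norm_le_incrementTail_of_le hd h0 hm).trans hp.le)

theorem kernel_eq_zero (hd : Summable fun n => ‖F n - F (n + 2)‖)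
    (h0 : Filter.Tendsto F Filter.atTop (nhds 0)) (hM : MarchenkoEq F k) {p : ℕ}
    (hp : incrementTail F p = 0) (hn : p ≤ 2 * n) (m : ℕ) : k n m = 0 := by
  have h := hM n m
  have hz : ∀ l, F (2 * n + m + 2 + l) = 0 := fun l =>
    eq_zero_of_incrementTail_eq_zero hd h0 hp (by omega)
  rw [eq_zero_of_incrementTail_eq_zero hd h0 hp (show p ≤ 2 * n + m + 1 by omega)] at h
  simpa [hz] using h

theorem marchenkoDiag_eq_one (hd : Summable fun n => ‖F n - F (n + 2)‖)
    (h0 : Filter.Tendsto F Filter.atTop (nhds 0)) {p : ℕ}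
    (hp : incrementTail F p = 0) (hn : p ≤ 2 * n) : marchenkoDiag F k n = 1 := by
  have hz : ∀ l, F (2 * n + 1 + l) = 0 := fun l =>
    eq_zero_of_incrementTail_eq_zero hd h0 hp (by omega)
  rw [marchenkoDiag, eq_zero_of_incrementTail_eq_zero hd h0 hp hn]
  simp [hz]

/-- The estimate of the Jacobi parameters through the Marchenko equation. -/
theorem exists_bound_of_marchenkoEq {a b A : ℕ → ℝ} (hd : Summable fun n => ‖F n - F (n + 2)‖)
    (hF : Summable fun n => ‖F n‖) (hk : ∀ n, Summable fun l => ‖k n l‖)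
    (hM : MarchenkoEq F k) (ha : ∀ n, 0 < a n) (hA : ∀ n, 0 < A n)
    (hA1 : Filter.Tendsto A Filter.atTop (nhds 1))
    (hAa : ∀ n, A n = 2 * a n * A (n + 1)) (hb : ∀ n, (2 * b (n + 1) : ℂ) = k (n + 1) 0 - k n 0)
    (hdiag : ∀ n, 1 ≤ n → marchenkoDiag F k n = (A n : ℂ) ^ 2) :
    ∃ C : ℝ, ∀ n : ℕ, |2 * a (n + 1) - 1| + |b (n + 1)| ≤
      C * (‖F (2 * n + 1) - F (2 * n + 3)‖ + ‖F (2 * n + 2) - F (2 * n + 4)‖ +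
        incrementTail F (2 * n) ^ 2) := by
  have h0 : Filter.Tendsto F Filter.atTop (nhds 0) :=
    tendsto_zero_iff_norm_tendsto_zero.2 hF.tendsto_atTop_zero
  have hbn : ∀ n, 2 * |b (n + 1)| = ‖k n 0 - k (n + 1) 0‖ := fun n => by
    rw [norm_sub_rev, ← hb, norm_mul, Complex.norm_real, Real.norm_eq_abs]
    simp
  -- `A (n + 1) ^ 2 - A (n + 2) ^ 2 = (2 a - 1) (2 a + 1) A (n + 2) ^ 2` with `a = a (n + 1)`, and
  -- `2 a + 1 ≥ 1`.
  have han : ∀ n, |2 * a (n + 1) - 1| * A (n + 2) ^ 2 ≤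
      ‖marchenkoDiag F k (n + 1) - marchenkoDiag F k (n + 2)‖ := fun n => by
    rw [hdiag _ (by omega), hdiag _ (by omega)]
    have e : ((A (n + 1) : ℂ) ^ 2 - (A (n + 2) : ℂ) ^ 2) =
        (((2 * a (n + 1) - 1) * ((2 * a (n + 1) + 1) * A (n + 2) ^ 2) : ℝ) : ℂ) := by
      rw [hAa (n + 1)]
      push_cast
      ring
    have h1 : 0 ≤ A (n + 2) ^ 2 := sq_nonneg _
    have h2 := ha (n + 1)
    rw [e, Complex.norm_real, Real.norm_eq_abs, abs_mul,
      abs_of_nonneg (a := (2 * a (n + 1) + 1) * A (n + 2) ^ 2) (by positivity)]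
    refine mul_le_mul_of_nonneg_left ?_ (abs_nonneg _)
    nlinarith
  set R : ℕ → ℝ := fun n => ‖F (2 * n + 1) - F (2 * n + 3)‖ + ‖F (2 * n + 2) - F (2 * n + 4)‖ +
        incrementTail F (2 * n) ^ 2 with hR
  have hR0 : ∀ n, 0 ≤ R n := fun n => by positivity
  -- A constant for each single index. If the tail is zero, `F` vanishes from `2 * n` on, hence so
  -- do the kernels, and the left side is 0; otherwise `R n > 0` and one may divide by it.
  have hpt : ∀ n, ∃ C : ℝ, 0 ≤ C ∧ |2 * a (n + 1) - 1| + |b (n + 1)| ≤ C * R n := by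
    intro n
    by_cases hT : incrementTail F (2 * n) = 0
    · refine ⟨0, le_rfl, ?_⟩
      have e1 : |b (n + 1)| = 0 := by
        have := hbn n
        rw [kernel_eq_zero hd h0 hM hT le_rfl, kernel_eq_zero hd h0 hM hT (by omega)] at this
        simpa using this
      have e2 := han n
      rw [marchenkoDiag_eq_one hd h0 hT (by omega), marchenkoDiag_eq_one hd h0 hT (by omega),
        sub_self, norm_zero] at e2
      have e3 : |2 * a (n + 1) - 1| ≤ 0 := by
        have := sq_pos_of_pos (hA (n + 2))
        by_contra! h
        nlinarith
      linarith
    · have hpos : 0 < R n := by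
        have : 0 < incrementTail F (2 * n) ^ 2 := by positivity
        simp only [hR]
        positivity
      refine ⟨(|2 * a (n + 1) - 1| + |b (n + 1)|) / R n, by positivity, ?_⟩
      rw [div_mul_cancel₀ _ hpos.ne']
  choose C hC0 hC using hpt
  -- a common constant for all large indices
  have hsmall : ∀ᶠ n in Filter.atTop, ∑' j, ‖F (2 * n + j)‖ ≤ 1 / 2 := by
    have h := tendsto_sum_nat_add fun n => ‖F n‖
    have h2 : Filter.Tendsto (fun n : ℕ => 2 * n) Filter.atTop Filter.atTop :=
      Filter.tendsto_atTop_mono (fun N => by simp only [id]; omega) Filter.tendsto_id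
    have h3 := (h.comp h2).eventually (eventually_le_nhds (show (0 : ℝ) < 1 / 2 by norm_num))
    filter_upwards [h3] with n hn
    simpa [add_comm] using hn
  have hAs : ∀ᶠ n in Filter.atTop, 1 / 2 ≤ A n ^ 2 := by
    have := hA1.pow 2
    rw [one_pow] at this
    exact this.eventually (eventually_ge_nhds (by norm_num))
  obtain ⟨N, hN⟩ := Filter.eventually_atTop.1 (hsmall.and hAs)
  -- The sum serves the indices below `N`. Beyond, `1 / 2 ≤ A n ^ 2` costs a factor 2, so the
  -- quadratic terms amount to `2 * 6 + 6 / 2 = 15`, which 18 covers.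
  refine ⟨∑ n ∈ Finset.range N, C n + 18, fun n => ?_⟩
  have hS : 0 ≤ ∑ n ∈ Finset.range N, C n := Finset.sum_nonneg fun i _ => hC0 i
  rcases lt_or_ge n N with hlt | hge
  · refine (hC n).trans (mul_le_mul_of_nonneg_right ?_ (hR0 n))
    have := Finset.single_le_sum (f := C) (fun i _ => hC0 i) (Finset.mem_range.2 hlt)
    linarith
  · have b1 := norm_kernel_zero_sub_le hd hF hk hM (hN n hge).1
    have b2 := norm_marchenkoDiag_sub_le hd hF hk hM (hN (n + 1) (by omega)).1
    have b3 := (hN (n + 2) (by omega)).2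
    have b4 := han n
    have b5 := hbn n
    have hanti : incrementTail F (2 * (n + 1)) ^ 2 ≤ incrementTail F (2 * n) ^ 2 :=
      pow_le_pow_left₀ (incrementTail_nonneg _ _) (incrementTail_anti hd (by omega)) 2
    rw [show 2 * (n + 1) = 2 * n + 2 by ring] at b2 hanti
    have b6 : |2 * a (n + 1) - 1| ≤ 2 * (|2 * a (n + 1) - 1| * A (n + 2) ^ 2) := by
      nlinarith [abs_nonneg (2 * a (n + 1) - 1)]
    have hSR := mul_nonneg hS (hR0 n)
    change _ ≤ _ * R n
    rw [add_mul]
    have b7 : R n = ‖F (2 * n + 1) - F (2 * n + 3)‖ + ‖F (2 * n + 2) - F (2 * n + 4)‖ +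
        incrementTail F (2 * n) ^ 2 := rfl
    have := norm_nonneg (F (2 * n + 1) - F (2 * n + 3))
    have := norm_nonneg (F (2 * n + 2) - F (2 * n + 4))
    have b2' : ‖marchenkoDiag F k (n + 1) - marchenkoDiag F k (n + 2)‖ ≤
      ‖F (2 * n + 2) - F (2 * n + 4)‖ + 6 * incrementTail F (2 * n + 2) ^ 2 := b2
    linarith [sq_nonneg (incrementTail F (2 * n))]

end Sequences

/-! ### Backward recurrence in a Banach space -/

section Volterra

variable {A : Type*} [NormedAddCommGroup A] [NormedSpace ℝ A]

/-- The source term of the backward three-term recurrence. -/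
noncomputable def recurrenceSource (Z : A →L[ℝ] A) (c b : ℕ → ℝ) (g : ℕ → A) (j : ℕ) : A :=
  c j • Z (Z (g (j + 1))) - (2 * b j) • Z (g j)

/-- The geometric sums `∑_{i < k} Z ^ (2 i)`. -/
noncomputable def geomKernel (Z : A →L[ℝ] A) : ℕ → A →L[ℝ] A
  | 0 => 0
  | k + 1 => 1 + Z * Z * geomKernel Z k

variable {Z : A →L[ℝ] A}

theorem norm_recurrenceSource_le (hZ : ∀ x, ‖Z x‖ ≤ ‖x‖) (c b : ℕ → ℝ) {g : ℕ → A} {M : ℝ}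
    (hg : ∀ n, ‖g n‖ ≤ M) (j : ℕ) :
    ‖recurrenceSource Z c b g j‖ ≤ (|c j| + 2 * |b j|) * M := by
  refine (norm_sub_le _ _).trans ?_
  rw [norm_smul, norm_smul, Real.norm_eq_abs, Real.norm_eq_abs, abs_mul, abs_two, add_mul]
  have h1 := (hZ (Z (g (j + 1)))).trans ((hZ _).trans (hg _))
  have h2 := (hZ (g j)).trans (hg _)
  gcongr

theorem norm_geomKernel_apply_le (hZ : ∀ x, ‖Z x‖ ≤ ‖x‖) (k : ℕ) (x : A) :
    ‖geomKernel Z k x‖ ≤ k * ‖x‖ := by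
  induction k with
  | zero => simp [geomKernel]
  | succ k ih =>
    have h : ‖x + Z (Z (geomKernel Z k x))‖ ≤ ‖x‖ + k * ‖x‖ :=
      (norm_add_le _ _).trans (add_le_add le_rfl ((hZ _).trans ((hZ _).trans ih)))
    push_cast
    rw [add_mul, one_mul, add_comm (_ * _)]
    exact h

theorem geomKernel_succ_apply (k : ℕ) (x : A) :
    geomKernel Z (k + 1) x = x + Z (Z (geomKernel Z k x)) := rfl

variable [CompleteSpace A]

theorem summable_geomKernel (hZ : ∀ x, ‖Z x‖ ≤ ‖x‖) {r : ℕ → A}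
    (hr : Summable fun j : ℕ => ((j : ℝ) + 1) * ‖r j‖) (n : ℕ) :
    Summable fun j => geomKernel Z (j + 1) (r (n + j)) := by
  have hr' := summable_shift hr n
  refine Summable.of_norm_bounded hr' fun j => ?_
  refine (norm_geomKernel_apply_le hZ _ _).trans ?_
  push_cast
  gcongr
  have : (0 : ℝ) ≤ n := Nat.cast_nonneg n
  linarith

/-- Variation of constants: increments `d n = r n + Z² (d (n + 1))` sum to the displayed series,
because consecutive kernels satisfy `geomKernel (k + 2) - geomKernel (k + 1) = Z² (geomKernel (k +
1) - geomKernel k)`. -/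
theorem tsum_geomKernel_recurrence (hZ : ∀ x, ‖Z x‖ ≤ ‖x‖) {r : ℕ → A}
    (hr : Summable fun j : ℕ => ((j : ℝ) + 1) * ‖r j‖) (n : ℕ) :
    ∑' j, geomKernel Z (j + 1) (r (n + j)) - ∑' j, geomKernel Z (j + 1) (r (n + 1 + j)) =
      r n + Z (Z (∑' j, geomKernel Z (j + 1) (r (n + 1 + j)) -
        ∑' j, geomKernel Z (j + 1) (r (n + 2 + j)))) := by
  have hs := summable_geomKernel hZ hr
  have hs' : ∀ n, Summable fun j => geomKernel Z (j + 2) (r (n + 1 + j)) := fun n => by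
    have := (summable_nat_add_iff 1).2 (hs n)
    refine this.congr fun j => ?_
    rw [show n + (j + 1) = n + 1 + j by ring]
  have e : ∀ n, ∑' j, geomKernel Z (j + 1) (r (n + j)) =
      r n + ∑' j, geomKernel Z (j + 2) (r (n + 1 + j)) := fun n => by
    rw [(hs n).tsum_eq_zero_add]
    congr 1
    · simp [geomKernel]
    · congr 1
      ext j
      rw [show n + (j + 1) = n + 1 + j by ring]
  have e2 : ∑' j, geomKernel Z (j + 2) (r (n + 1 + j)) -
      ∑' j, geomKernel Z (j + 1) (r (n + 1 + j)) =
      Z (Z (∑' j, geomKernel Z (j + 1) (r (n + 1 + j)) -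
        ∑' j, geomKernel Z (j + 1) (r (n + 2 + j)))) := by
    change _ = (Z * Z) _
    have hD := (hs' (n + 1)).sub (hs (n + 2))
    have hE := (hs' n).sub (hs (n + 1))
    rw [← (hs' n).tsum_sub (hs (n + 1)), e (n + 1), add_sub_assoc,
      ← (hs' (n + 1)).tsum_sub (hs (n + 2)), map_add, (Z * Z).map_tsum hD, hE.tsum_eq_zero_add]
    congr 1
    · simp [geomKernel]
    · congr 1
      ext j
      rw [show n + 1 + (j + 1) = n + 2 + j by ring, geomKernel_succ_apply (j + 2),
        geomKernel_succ_apply (j + 1), map_sub, show n + 1 + 1 + j = n + 2 + j by ring]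
      change _ = Z (Z _) - Z (Z _)
      abel
  rw [← e2, e n]
  abel

/-- The backward recurrence with prescribed limit at infinity, for small perturbations. -/
theorem exists_recurrence_of_small (hZ : ∀ x, ‖Z x‖ ≤ ‖x‖) (e : A) {c b : ℕ → ℝ}
    (hs : Summable fun j : ℕ => ((j : ℝ) + 1) * (|c j| + 2 * |b j|))
    (hsmall : ∑' j : ℕ, ((j : ℝ) + 1) * (|c j| + 2 * |b j|) ≤ 1 / 2) :
    ∃ g : ℕ → A, (∀ n, g n - g (n + 1) - Z (Z (g (n + 1) - g (n + 2))) =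
      recurrenceSource Z c b g (n + 1)) ∧ Filter.Tendsto g Filter.atTop (nhds e) := by
  set ε : ℕ → ℝ := fun j => ((j : ℝ) + 1) * (|c j| + 2 * |b j|) with hε
  have hε0 : ∀ j, 0 ≤ ε j := fun j => by positivity
  have hsum : ∀ {g : ℕ → A} {M : ℝ}, (∀ n, ‖g n‖ ≤ M) →
      Summable fun j : ℕ => ((j : ℝ) + 1) * ‖recurrenceSource Z c b g j‖ := fun {g M} hg => by
    refine Summable.of_nonneg_of_le (fun j => by positivity) (fun j => ?_) (hs.mul_right M)
    rw [hε, mul_assoc]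
    gcongr
    exact norm_recurrenceSource_le hZ c b hg j
  -- The recurrence with limit `e` becomes `g = e + V g`. The kernel norm grows like `j + 1`, which
  -- is where the first moment is spent.
  set V : (ℕ → A) → ℕ → A := fun g n =>
    ∑' j, geomKernel Z (j + 1) (recurrenceSource Z c b g (n + 1 + j)) with hV
  have hVle : ∀ {g : ℕ → A} {M : ℝ}, (∀ n, ‖g n‖ ≤ M) → ∀ n,
      ‖V g n‖ ≤ (∑' j, ε (n + 1 + j)) * M := fun {g M} hg n => by
    refine tsum_of_norm_bounded ((summable_shift hs (n + 1)).hasSum.mul_right M) fun j => ?_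
    refine (norm_geomKernel_apply_le hZ _ _).trans ?_
    have h1 := norm_recurrenceSource_le hZ c b hg (n + 1 + j)
    have h2 : ((j + 1 : ℕ) : ℝ) ≤ (n + 1 + j : ℕ) + 1 := by
      push_cast
      have : (0 : ℝ) ≤ n := Nat.cast_nonneg n
      linarith
    calc _ ≤ (((n + 1 + j : ℕ) : ℝ) + 1) * ((|c (n + 1 + j)| + 2 * |b (n + 1 + j)|) * M) := by
          gcongr
      _ = _ := by rw [hε]; ring
  have htail : ∀ n, ∑' j, ε (n + j) ≤ 1 / 2 := fun n => by
    refine (tsum_shift_le hε0 hs (Nat.zero_le n)).trans ?_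
    simpa using hsmall
  have hVhalf : ∀ {g : ℕ → A} {M : ℝ}, 0 ≤ M → (∀ n, ‖g n‖ ≤ M) → ∀ n,
      ‖V g n‖ ≤ 1 / 2 * M := fun {g M} hM hg n =>
    (hVle hg n).trans (mul_le_mul_of_nonneg_right (htail _) hM)
  have hnorm : ∀ (g : BoundedContinuousFunction ℕ A) n, ‖g n‖ ≤ ‖g‖ := fun g n =>
    g.norm_coe_le_norm n
  have hVsub : ∀ (g h : BoundedContinuousFunction ℕ A) n,
      V g n - V h n = V (fun m => g m - h m) n := fun g h n => by
    rw [hV]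
    simp only
    rw [← (summable_geomKernel hZ (hsum (hnorm g)) (n + 1)).tsum_sub
      (summable_geomKernel hZ (hsum (hnorm h)) (n + 1))]
    congr 1
    ext j
    rw [← map_sub]
    congr 1
    simp only [recurrenceSource, map_sub, smul_sub]
    abel
  let T : BoundedContinuousFunction ℕ A → BoundedContinuousFunction ℕ A := fun g =>
    BoundedContinuousFunction.ofNormedAddCommGroupDiscrete (fun n => e + V g n)
      (‖e‖ + 1 / 2 * ‖g‖) fun n =>
        (norm_add_le _ _).trans (add_le_add le_rfl (hVhalf (norm_nonneg _) (hnorm g) n))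
  have hT : ContractingWith (1 / 2) T := by
    refine ⟨by norm_num, LipschitzWith.of_dist_le_mul fun g h => ?_⟩
    have hd : 0 ≤ dist g h := dist_nonneg
    rw [BoundedContinuousFunction.dist_le (by positivity)]
    intro n
    change dist (e + V g n) (e + V h n) ≤ _
    rw [dist_add_left, dist_eq_norm, hVsub]
    refine (hVhalf (M := dist g h) hd (fun m => ?_) n).trans (le_of_eq (by norm_num))
    rw [← dist_eq_norm]
    exact BoundedContinuousFunction.dist_coe_le_dist m
  have hfix := hT.fixedPoint_isFixedPt
  set g := ContractingWith.fixedPoint T hT with hg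
  have hgn : ∀ n, g n = e + V g n := fun n => by
    conv_lhs => rw [← hfix]
    rfl
  refine ⟨g, fun n => ?_, ?_⟩
  · have := tsum_geomKernel_recurrence hZ (hsum (hnorm g)) (n + 1)
    rw [hgn n, hgn (n + 1), hgn (n + 2)]
    simp only [add_sub_add_left_eq_sub]
    rw [sub_eq_iff_eq_add]
    exact this
  · have h0 : Filter.Tendsto (fun n => (∑' j, ε (n + 1 + j)) * ‖g‖) Filter.atTop (nhds 0) := by
      have := ((tendsto_sum_nat_add ε).comp (Filter.tendsto_add_atTop_nat 1)).mul_const ‖g‖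
      rw [zero_mul] at this
      refine this.congr fun n => ?_
      simp only [Function.comp]
      congr 2
      ext j
      rw [add_comm]
    have := squeeze_zero_norm (fun n => hVle (hnorm g) n) h0
    have := this.const_add e
    rw [add_zero] at this
    exact this.congr fun n => (hgn n).symm

/-- The backward recurrence with prescribed limit at infinity. -/
theorem exists_recurrence (hZ : ∀ x, ‖Z x‖ ≤ ‖x‖) (e : A) {c b : ℕ → ℝ}
    (hs : Summable fun j : ℕ => ((j : ℝ) + 1) * (|c j| + 2 * |b j|)) :
    ∃ g : ℕ → A, (∀ n, g n - g (n + 1) - Z (Z (g (n + 1) - g (n + 2))) =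
      recurrenceSource Z c b g (n + 1)) ∧ Filter.Tendsto g Filter.atTop (nhds e) := by
  -- The recurrence expresses `g N` through `g (N + 1)` and `g (N + 2)`, so a solution near infinity
  -- extends down to 0.
  have hdesc : ∀ N : ℕ, (∃ g : ℕ → A,
      (∀ n, N ≤ n → g n - g (n + 1) - Z (Z (g (n + 1) - g (n + 2))) =
        recurrenceSource Z c b g (n + 1)) ∧ Filter.Tendsto g Filter.atTop (nhds e)) →
      ∃ g : ℕ → A, (∀ n, g n - g (n + 1) - Z (Z (g (n + 1) - g (n + 2))) =
        recurrenceSource Z c b g (n + 1)) ∧ Filter.Tendsto g Filter.atTop (nhds e) := by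
    intro N
    induction N with
    | zero => exact fun ⟨g, h1, h2⟩ => ⟨g, fun n => h1 n (Nat.zero_le n), h2⟩
    | succ N ih =>
      rintro ⟨g, h1, h2⟩
      refine ih ⟨Function.update g N
        (g (N + 1) + Z (Z (g (N + 1) - g (N + 2))) + recurrenceSource Z c b g (N + 1)), ?_, ?_⟩
      · have hne : ∀ m, N < m → ∀ x : A, Function.update g N x m = g m := fun m hm x =>
          Function.update_of_ne (by omega) _ _
        intro n hn
        simp only [recurrenceSource]
        rw [hne (n + 1) (by omega), hne (n + 2) (by omega)]
        rcases hn.eq_or_lt with rfl | hlt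
        · rw [Function.update_self]
          abel
        · rw [hne n hlt]
          exact h1 n hlt
      · refine h2.congr' ?_
        filter_upwards [Filter.eventually_gt_atTop N] with n hn
        rw [Function.update_of_ne (by omega)]
  have hε0 : ∀ j : ℕ, 0 ≤ ((j : ℝ) + 1) * (|c j| + 2 * |b j|) := fun j => by positivity
  obtain ⟨N, hN⟩ := ((tendsto_sum_nat_add fun j : ℕ => ((j : ℝ) + 1) * (|c j| + 2 * |b j|)).eventually
    (eventually_le_nhds (show (0 : ℝ) < 1 / 2 by norm_num))).exists
  have hs1 := (summable_nat_add_iff N).2 hs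
  -- Cutting off the first `N` entries also lowers the weight from `j + N + 1` to `j + 1`, so the
  -- smallness of the tail carries over.
  have hle : ∀ j : ℕ, ((j : ℝ) + 1) * (|c (j + N)| + 2 * |b (j + N)|) ≤
      (((j + N : ℕ) : ℝ) + 1) * (|c (j + N)| + 2 * |b (j + N)|) := fun j => by
    gcongr
    exact Nat.le_add_right j N
  have hs2 : Summable fun j : ℕ => ((j : ℝ) + 1) * (|c (j + N)| + 2 * |b (j + N)|) :=
    Summable.of_nonneg_of_le (fun j => by positivity) hle hs1
  obtain ⟨g, h1, h2⟩ := exists_recurrence_of_small hZ e (c := fun j => c (j + N))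
    (b := fun j => b (j + N)) hs2 ((hs2.tsum_le_tsum hle hs1).trans hN)
  refine hdesc N ⟨fun n => g (n - N), fun n hn => ?_, h2.comp (Filter.tendsto_sub_atTop_nat N)⟩
  obtain ⟨i, rfl⟩ := Nat.exists_eq_add_of_le' hn
  have := h1 i
  simp only [recurrenceSource] at this ⊢
  rw [show i + N + 1 - N = i + 1 by omega, show i + N + 2 - N = i + 2 by omega,
    show i + N - N = i by omega,
    show i + N + 1 = i + 1 + N by ring]
  exact this

end Volterra

/-! ### Absolutely summable power series -/

section WienerShift

/-- The Banach space of absolutely summable real sequences. -/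
abbrev SummableSeq : Type := lp (fun _ : ℕ => ℝ) 1

theorem summable_norm_summableSeq (x : SummableSeq) : Summable fun n => ‖x n‖ := by
  simpa using (memℓp_gen_iff (by norm_num)).1 (lp.memℓp x)

theorem norm_summableSeq (x : SummableSeq) : ‖x‖ = ∑' n, ‖x n‖ := by
  rw [lp.norm_eq_tsum_rpow (by norm_num)]
  simp

/-- The right shift of a sequence. -/
def seqShift (x : ℕ → ℝ) : ℕ → ℝ
  | 0 => 0
  | n + 1 => x n

theorem memℓp_seqShift (x : SummableSeq) : Memℓp (seqShift x) 1 := by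
  refine (memℓp_gen_iff (by norm_num)).2 ?_
  rw [← summable_nat_add_iff 1]
  simpa [seqShift] using summable_norm_summableSeq x

/-- The right shift on absolutely summable sequences, as a linear map. -/
noncomputable def shiftLinear : SummableSeq →ₗ[ℝ] SummableSeq where
  toFun x := ⟨seqShift x, memℓp_seqShift x⟩
  map_add' x y := by
    ext n
    change seqShift (x + y : SummableSeq) n = seqShift x n + seqShift y n
    cases n <;> simp [seqShift]
  map_smul' r x := by
    ext n
    change seqShift (r • x : SummableSeq) n = r * seqShift x n
    cases n <;> simp [seqShift]

theorem shiftLinear_zero (x : SummableSeq) : shiftLinear x 0 = 0 := rfl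

theorem shiftLinear_succ (x : SummableSeq) (n : ℕ) : shiftLinear x (n + 1) = x n := rfl

theorem norm_shiftLinear (x : SummableSeq) : ‖shiftLinear x‖ = ‖x‖ := by
  rw [norm_summableSeq, norm_summableSeq, (summable_norm_summableSeq _).tsum_eq_zero_add]
  simp [shiftLinear_zero, shiftLinear_succ]

/-- The right shift on absolutely summable sequences. -/
noncomputable def wienerShift : SummableSeq →L[ℝ] SummableSeq :=
  shiftLinear.mkContinuous 1 fun x => by rw [norm_shiftLinear, one_mul]

theorem wienerShift_zero (x : SummableSeq) : wienerShift x 0 = 0 := rfl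

theorem wienerShift_succ (x : SummableSeq) (n : ℕ) : wienerShift x (n + 1) = x n := rfl

theorem wienerShift_one (x : SummableSeq) : wienerShift x 1 = x 0 := rfl

theorem norm_wienerShift_le (x : SummableSeq) : ‖wienerShift x‖ ≤ ‖x‖ := (norm_shiftLinear x).le

/-- The symbol of an absolutely summable sequence. -/
noncomputable def symbol (x : SummableSeq) (z : ℂ) : ℂ := ∑' n, (x n : ℂ) * z ^ n

theorem norm_symbol_term_le (x : SummableSeq) {z : ℂ} (hz : ‖z‖ ≤ 1) (n : ℕ) :
    ‖(x n : ℂ) * z ^ n‖ ≤ ‖x n‖ := by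
  rw [norm_mul, norm_pow, Complex.norm_real]
  exact mul_le_of_le_one_right (norm_nonneg _) (pow_le_one₀ (norm_nonneg _) hz)

theorem summable_symbol (x : SummableSeq) {z : ℂ} (hz : ‖z‖ ≤ 1) :
    Summable fun n => (x n : ℂ) * z ^ n :=
  Summable.of_norm_bounded (summable_norm_summableSeq x) (norm_symbol_term_le x hz)

theorem norm_symbol_le (x : SummableSeq) {z : ℂ} (hz : ‖z‖ ≤ 1) : ‖symbol x z‖ ≤ ‖x‖ := by
  rw [norm_summableSeq]
  exact tsum_of_norm_bounded (summable_norm_summableSeq x).hasSum (norm_symbol_term_le x hz)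

theorem symbol_add (x y : SummableSeq) {z : ℂ} (hz : ‖z‖ ≤ 1) :
    symbol (x + y) z = symbol x z + symbol y z := by
  rw [symbol, symbol, symbol, ← (summable_symbol x hz).tsum_add (summable_symbol y hz)]
  congr 1
  ext n
  simp [add_mul]

theorem symbol_smul (r : ℝ) (x : SummableSeq) (z : ℂ) :
    symbol (r • x) z = r * symbol x z := by
  rw [symbol, symbol, ← tsum_mul_left]
  congr 1
  ext n
  simp [mul_assoc]

theorem symbol_sub (x y : SummableSeq) {z : ℂ} (hz : ‖z‖ ≤ 1) :
    symbol (x - y) z = symbol x z - symbol y z := by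
  rw [eq_sub_iff_add_eq, ← symbol_add _ _ hz, sub_add_cancel]

theorem symbol_shift (x : SummableSeq) {z : ℂ} (hz : ‖z‖ ≤ 1) :
    symbol (wienerShift x) z = z * symbol x z := by
  rw [symbol, symbol, (summable_symbol _ hz).tsum_eq_zero_add, ← tsum_mul_left]
  simp only [wienerShift_zero, wienerShift_succ, Complex.ofReal_zero, zero_mul, zero_add]
  congr 1
  ext n
  ring

theorem symbol_zero (x : SummableSeq) : symbol x 0 = x 0 := by
  rw [symbol, tsum_eq_single 0 (fun n hn => by simp [hn])]
  simp

theorem continuousOn_symbol (x : SummableSeq) :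
    ContinuousOn (symbol x) (Metric.closedBall 0 1) :=
  continuousOn_tsum (fun n => by fun_prop) (summable_norm_summableSeq x)
    fun n z hz => norm_symbol_term_le x (by simpa using hz) n

/-- Absolute summability gives continuity up to the boundary, so the mean value property is
available on the unit circle itself. -/
theorem diffContOnCl_symbol (x : SummableSeq) : DiffContOnCl ℂ (symbol x) (Metric.ball 0 1) := by
  refine ⟨?_, ?_⟩
  · exact Complex.differentiableOn_tsum_of_summable_norm (summable_norm_summableSeq x)
      (fun n => by fun_prop) Metric.isOpen_ball
      fun n z hz => norm_symbol_term_le x (by simpa using (Metric.ball_subset_closedBall hz)) n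
  · rw [closure_ball _ one_ne_zero]
    exact continuousOn_symbol x

end WienerShift

/-! ### The Jost solution: kernel, existence and uniqueness -/

namespace JacobiMatrix

/-- A solution of the three-term recurrence with spectral parameter `x`. -/
def Solves (J : JacobiMatrix) (x : ℂ) (u : ℕ → ℂ) : Prop :=
  ∀ n : ℕ, (J.a n : ℂ) * u n + (J.b (n + 1) : ℂ) * u (n + 1) + (J.a (n + 1) : ℂ) * u (n + 2) =
    x * u (n + 1)

/-- Cross-multiplying the two recurrences cancels the diagonal and spectral terms. The normalization
`a 0 = 1` removes the factor at index 0. -/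
theorem wronskian_eq {J : JacobiMatrix} {x : ℂ} {u v : ℕ → ℂ} (hu : J.Solves x u)
    (hv : J.Solves x v) (n : ℕ) :
    (J.a n : ℂ) * (u n * v (n + 1) - u (n + 1) * v n) = u 0 * v 1 - u 1 * v 0 := by
  induction n with
  | zero => simp [J.a_zero]
  | succ n ih =>
    rw [← ih]
    linear_combination u (n + 1) * hv n - v (n + 1) * hu n

theorem Solves.sub {J : JacobiMatrix} {x : ℂ} {u v : ℕ → ℂ} (hu : J.Solves x u)
    (hv : J.Solves x v) : J.Solves x fun n => u n - v n := fun n => by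
  linear_combination hu n - hv n

/-- A solution vanishing at two consecutive indices vanishes below them. -/
theorem Solves.eq_zero_of_le {J : JacobiMatrix} {x : ℂ} {u : ℕ → ℂ} (hu : J.Solves x u) (N : ℕ)
    (h1 : u N = 0) (h2 : u (N + 1) = 0) : ∀ n, n ≤ N → u n = 0 := by
  induction N with
  | zero =>
    intro n hn
    rwa [Nat.le_zero.1 hn]
  | succ N ih =>
    have h3 : u N = 0 := by
      have := hu N
      rw [h1, h2, mul_zero, mul_zero, mul_zero, add_zero, add_zero] at this
      exact (mul_eq_zero.1 this).resolve_left (Complex.ofReal_ne_zero.2 (J.a_pos N).ne')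
    intro n hn
    rcases Nat.le_succ_iff.1 hn with h | rfl
    · exact ih h3 h1 n h
    · exact h1

/-- The kernel of the transformation operator in normalized form: `g n` is the sequence of
coefficients of `A n * f n z * z ^ (-n)` for the Jost solution `f`, with `A n = ∏ 2 a j`
over `j ≥ n`. -/
structure JostKernel (J : JacobiMatrix) where
  g : ℕ → SummableSeq
  A : ℕ → ℝ
  recurrence : ∀ n, g n - g (n + 1) - wienerShift (wienerShift (g (n + 1) - g (n + 2))) =
    recurrenceSource wienerShift (fun j => 1 - 4 * J.a j ^ 2) J.b g (n + 1)
  tendsto_g : Filter.Tendsto g Filter.atTop (nhds (lp.single 1 0 1))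
  A_pos : ∀ n, 0 < A n
  A_eq : ∀ n, A n = 2 * J.a n * A (n + 1)
  tendsto_A : Filter.Tendsto A Filter.atTop (nhds 1)

theorem summable_perturbation {J : JacobiMatrix} (hm : J.HasFiniteFirstMoment) :
    Summable fun n : ℕ => |J.a n - 1 / 2| + |J.b n| :=
  summable_of_summable_nat_mul (fun _ => by positivity) hm

theorem nonempty_jostKernel {J : JacobiMatrix} (hm : J.HasFiniteFirstMoment) :
    Nonempty J.JostKernel := by
  have hs := summable_perturbation hm
  obtain ⟨M, hM⟩ := J.bdd
  have hM0 : 0 ≤ M := (abs_nonneg _).trans (hM 0).1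
  have h1 : Summable fun j : ℕ => ((j : ℝ) + 1) * (|1 - 4 * J.a j ^ 2| + 2 * |J.b j|) := by
    have hm' : Summable fun j : ℕ => ((j : ℝ) + 1) * (|J.a j - 1 / 2| + |J.b j|) := by
      simpa [add_mul] using Summable.add hm hs
    refine Summable.of_nonneg_of_le (fun j => by positivity) (fun j => ?_)
      (hm'.mul_left (2 + 4 * M))
    have e : |1 - 4 * J.a j ^ 2| = (2 + 4 * J.a j) * |J.a j - 1 / 2| := by
      rw [show 1 - 4 * J.a j ^ 2 = -((2 + 4 * J.a j) * (J.a j - 1 / 2)) by ring, abs_neg, abs_mul,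
        abs_of_pos (by linarith [J.a_pos j])]
    have h2 : J.a j ≤ M := (le_abs_self _).trans (hM j).1
    have h3 : |1 - 4 * J.a j ^ 2| + 2 * |J.b j| ≤
        (2 + 4 * M) * (|J.a j - 1 / 2| + |J.b j|) := by
      rw [e]
      nlinarith [abs_nonneg (J.a j - 1 / 2), abs_nonneg (J.b j)]
    calc _ ≤ ((j : ℝ) + 1) * ((2 + 4 * M) * (|J.a j - 1 / 2| + |J.b j|)) := by gcongr
      _ = _ := by ring
  obtain ⟨g, hg, hg1⟩ := exists_recurrence norm_wienerShift_le (lp.single 1 0 1) h1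
  have hlog : Summable fun n => Real.log (2 * J.a n) := by
    have : Summable fun n => 2 * J.a n - 1 := by
      refine Summable.of_norm_bounded (hs.mul_left 2) fun n => ?_
      rw [Real.norm_eq_abs, show 2 * J.a n - 1 = 2 * (J.a n - 1 / 2) by ring, abs_mul, abs_two]
      gcongr
      linarith [abs_nonneg (J.b n)]
    refine (Real.summable_log_one_add_of_summable this).congr fun n => ?_
    congr 1
    ring
  refine ⟨⟨g, fun n => Real.exp (∑' j, Real.log (2 * J.a (j + n))), hg, hg1,
    fun n => Real.exp_pos _, fun n => ?_, ?_⟩⟩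
  · rw [((summable_nat_add_iff n).2 hlog).tsum_eq_zero_add, Real.exp_add, zero_add,
      Real.exp_log (by linarith [J.a_pos n])]
    congr 3
    ext j
    rw [show j + 1 + n = j + (n + 1) by ring]
  · have := (Real.continuous_exp.tendsto 0).comp (tendsto_sum_nat_add fun n => Real.log (2 * J.a n))
    rwa [Real.exp_zero] at this

namespace JostKernel

variable {J : JacobiMatrix} (K : J.JostKernel)

/-- Every other term of the recurrence lies in the range of the shift and has no zeroth coordinate.
-/
theorem g_zero_eq (n : ℕ) : K.g n 0 = K.g (n + 1) 0 := by
  have := congrArg (fun x : SummableSeq => x 0) (K.recurrence n)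
  simp only [recurrenceSource, lp.coeFn_sub, lp.coeFn_smul, Pi.sub_apply, Pi.smul_apply,
    wienerShift_zero, smul_zero, sub_zero] at this
  linarith

theorem g_zero (n : ℕ) : K.g n 0 = 1 := by
  have hc : ∀ m, K.g (n + m) 0 = K.g n 0 := fun m => by
    induction m with
    | zero => rfl
    | succ m ih => rw [← ih, ← add_assoc, ← K.g_zero_eq]
  have ht : Filter.Tendsto (fun m => K.g (n + m) 0) Filter.atTop (nhds 1) := by
    have h := ((lp.lipschitzWith_one_eval (E := fun _ : ℕ => ℝ) 1 0).continuous.tendsto _).comp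
      K.tendsto_g
    simp only [lp.single_apply_self] at h
    have h2 := h.comp (Filter.tendsto_add_atTop_nat n)
    refine h2.congr fun m => ?_
    simp [add_comm]
  simp only [hc] at ht
  exact tendsto_nhds_unique tendsto_const_nhds ht

/-- In degree one the double shifts drop out and the single shift contributes `g (n + 1) 0 = 1`. -/
theorem g_one_sub (n : ℕ) : 2 * J.b (n + 1) = K.g (n + 1) 1 - K.g n 1 := by
  have := congrArg (fun x : SummableSeq => x 1) (K.recurrence n)
  simp only [recurrenceSource, lp.coeFn_sub, lp.coeFn_smul, Pi.sub_apply, Pi.smul_apply,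
    wienerShift_one, wienerShift_zero, K.g_zero, smul_eq_mul] at this
  linarith

/-- The power series `∑ κ(n, l) z ^ l`. -/
noncomputable def G (n : ℕ) (z : ℂ) : ℂ := symbol (K.g n) z

theorem G_recurrence (n : ℕ) {z : ℂ} (hz : ‖z‖ ≤ 1) :
    K.G n z - K.G (n + 1) z - z ^ 2 * (K.G (n + 1) z - K.G (n + 2) z) =
      (1 - 4 * (J.a (n + 1) : ℂ) ^ 2) * z ^ 2 * K.G (n + 2) z -
        2 * J.b (n + 1) * z * K.G (n + 1) z := by
  have := congrArg (fun x => symbol x z) (K.recurrence n)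
  simp only [recurrenceSource, symbol_sub _ _ hz, symbol_smul, symbol_shift _ hz] at this
  simp only [G]
  push_cast at this
  linear_combination this

theorem norm_G_sub_one_le (n : ℕ) {z : ℂ} (hz : ‖z‖ ≤ 1) :
    ‖K.G n z - 1‖ ≤ ‖K.g n - lp.single 1 0 1‖ := by
  have h1 : symbol (lp.single 1 0 1) z = 1 := by
    rw [symbol, tsum_eq_single 0]
    · rw [lp.single_apply_self]
      simp
    · intro m hm
      rw [lp.single_apply_ne _ _ _ hm]
      simp
  rw [← h1, G, ← symbol_sub _ _ hz]
  exact norm_symbol_le _ hz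

/-- The Jost solution built from its kernel. -/
noncomputable def jost (n : ℕ) (z : ℂ) : ℂ := z ^ n * (K.G n z / K.A n)

theorem A_ne (n : ℕ) : (K.A n : ℂ) ≠ 0 := Complex.ofReal_ne_zero.2 (K.A_pos n).ne'

/-- With the factors `A n` divided out, the off-diagonal entries enter only through `4 a²`: the
equation reads `G n + 2 b z G (n + 1) + 4 a² z² G (n + 2) = (1 + z²) G (n + 1)`, with `a`, `b` taken
at `n + 1`. -/
theorem solves_jost {z : ℂ} (hz0 : z ≠ 0) (hz : ‖z‖ ≤ 1) :
    J.Solves ((z + z⁻¹) / 2) fun n => K.jost n z := by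
  intro n
  have h := K.G_recurrence n hz
  have h1 := K.A_ne (n + 2)
  have h2 : (J.a n : ℂ) ≠ 0 := Complex.ofReal_ne_zero.2 (J.a_pos n).ne'
  have h3 : (J.a (n + 1) : ℂ) ≠ 0 := Complex.ofReal_ne_zero.2 (J.a_pos (n + 1)).ne'
  simp only [jost]
  rw [K.A_eq n, K.A_eq (n + 1)]
  push_cast
  rw [pow_succ, pow_succ]
  field_simp
  linear_combination z ^ n * h

theorem tendstoUniformlyOn_jost :
    TendstoUniformlyOn (fun (n : ℕ) (z : ℂ) => K.G n z / K.A n) (fun _ => 1) Filter.atTop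
      {z : ℂ | ‖z‖ ≤ 1} := by
  rw [Metric.tendstoUniformlyOn_iff]
  intro ε hε
  have hlim : Filter.Tendsto (fun n => (‖K.g n - lp.single 1 0 1‖ + |K.A n - 1|) / K.A n)
      Filter.atTop (nhds 0) := by
    have h1 : Filter.Tendsto (fun n => ‖K.g n - lp.single 1 0 1‖) Filter.atTop (nhds 0) :=
      tendsto_iff_norm_sub_tendsto_zero.1 K.tendsto_g
    have h2 : Filter.Tendsto (fun n => |K.A n - 1|) Filter.atTop (nhds 0) :=
      tendsto_iff_norm_sub_tendsto_zero.1 K.tendsto_A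
    have := (h1.add h2).div K.tendsto_A one_ne_zero
    rwa [add_zero, zero_div] at this
  filter_upwards [hlim.eventually (gt_mem_nhds hε)] with n hn z hz
  refine lt_of_le_of_lt ?_ hn
  have hA := K.A_pos n
  rw [dist_comm, dist_eq_norm, div_sub_one (K.A_ne n), norm_div, Complex.norm_real,
    Real.norm_of_nonneg hA.le]
  refine div_le_div_of_nonneg_right ?_ hA.le
  rw [show K.G n z - K.A n = (K.G n z - 1) - ((K.A n - 1 : ℝ) : ℂ) by push_cast; ring]
  refine (norm_sub_le _ _).trans (add_le_add (K.norm_G_sub_one_le n hz) ?_)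
  rw [Complex.norm_real, Real.norm_eq_abs]

theorem isJostSolution_jost : J.IsJostSolution K.jost := by
  refine ⟨fun z hz0 hz n => K.solves_jost hz0 hz n, ?_⟩
  refine (K.tendstoUniformlyOn_jost.mono fun z hz => hz.2).congr ?_
  filter_upwards with n z hz
  have : z ≠ 0 := hz.1
  simp only [jost]
  field_simp

theorem tendsto_a (K : J.JostKernel) : Filter.Tendsto (fun n => (J.a n : ℂ)) Filter.atTop (nhds (1 / 2)) := by
  have h : Filter.Tendsto (fun n => K.A n / (2 * K.A (n + 1))) Filter.atTop (nhds (1 / (2 * 1))) :=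
    K.tendsto_A.div ((K.tendsto_A.comp (Filter.tendsto_add_atTop_nat 1)).const_mul 2) (by norm_num)
  have h' : Filter.Tendsto J.a Filter.atTop (nhds (1 / 2)) := by
    rw [mul_one] at h
    refine h.congr fun n => ?_
    have := (K.A_pos (n + 1)).ne'
    rw [K.A_eq n]
    field_simp
  have := (Complex.continuous_ofReal.tendsto _).comp h'
  simpa [Function.comp_def] using this

end JostKernel

theorem IsJostSolution.tendsto {J : JacobiMatrix} {f : ℕ → ℂ → ℂ} (hf : J.IsJostSolution f) {z : ℂ}
    (hz0 : z ≠ 0) (hz : ‖z‖ ≤ 1) :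
    Filter.Tendsto (fun n => f n z * (z ^ n)⁻¹) Filter.atTop (nhds 1) :=
  hf.2.tendsto_at ⟨hz0, hz⟩

/-- Uniqueness of the Jost solution. -/
theorem IsJostSolution.eq {J : JacobiMatrix} (K : J.JostKernel) {f g : ℕ → ℂ → ℂ}
    (hf : J.IsJostSolution f) (hg : J.IsJostSolution g) {z : ℂ} (hz0 : z ≠ 0) (hz : ‖z‖ ≤ 1)
    (n : ℕ) : f n z = g n z := by
  have hfs : J.Solves ((z + z⁻¹) / 2) fun n => f n z := hf.1 z hz0 hz
  have hgs : J.Solves ((z + z⁻¹) / 2) fun n => g n z := hg.1 z hz0 hz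
  set p : ℕ → ℂ := fun n => f n z * (z ^ n)⁻¹ with hp
  set q : ℕ → ℂ := fun n => g n z * (z ^ n)⁻¹ with hq
  have hp1 : Filter.Tendsto p Filter.atTop (nhds 1) := hf.tendsto hz0 hz
  have hq1 : Filter.Tendsto q Filter.atTop (nhds 1) := hg.tendsto hz0 hz
  have hfp : ∀ n, f n z = z ^ n * p n := fun n => by
    simp only [hp]
    field_simp
  have hgq : ∀ n, g n z = z ^ n * q n := fun n => by
    simp only [hq]
    field_simp
  have hsh := Filter.tendsto_add_atTop_nat 1
  -- The weighted Wronskian is constant in `n` and tends to 0. This also works for `‖z‖ = 1`, since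
  -- `p` and `q` have the same limit 1.
  have hw : f 0 z * g 1 z - f 1 z * g 0 z = 0 := by
    have h1 : Filter.Tendsto (fun n => (J.a n : ℂ) * (p n * q (n + 1) - p (n + 1) * q n))
        Filter.atTop (nhds 0) := by
      have := K.tendsto_a.mul ((hp1.mul (hq1.comp hsh)).sub ((hp1.comp hsh).mul hq1))
      simpa using this
    have h2 : Filter.Tendsto (fun n => (J.a n : ℂ) *
        (f n z * g (n + 1) z - f (n + 1) z * g n z)) Filter.atTop (nhds 0) := by
      refine squeeze_zero_norm (fun n => ?_) (tendsto_zero_iff_norm_tendsto_zero.1 h1)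
      rw [show (J.a n : ℂ) * (f n z * g (n + 1) z - f (n + 1) z * g n z) =
        z ^ (2 * n + 1) * ((J.a n : ℂ) * (p n * q (n + 1) - p (n + 1) * q n)) by
          rw [hfp, hfp, hgq, hgq]; ring, norm_mul, norm_pow]
      exact mul_le_of_le_one_left (norm_nonneg _) (pow_le_one₀ (norm_nonneg _) hz)
    simp only [wronskian_eq hfs hgs] at h2
    exact tendsto_nhds_unique tendsto_const_nhds h2
  have hne : ∀ᶠ n in Filter.atTop, q n ≠ 0 := hq1.eventually_ne one_ne_zero
  obtain ⟨N, hN⟩ := Filter.eventually_atTop.1 hne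
  have hgne : ∀ n, N ≤ n → g n z ≠ 0 := fun n hn => by
    rw [hgq]
    exact mul_ne_zero (pow_ne_zero _ hz0) (hN n hn)
  -- A vanishing Wronskian makes the ratio constant, and its limit forces it to be 1; the equality
  -- then propagates down from `N + n`.
  have hratio : ∀ m, f (N + m) z / g (N + m) z = f N z / g N z := fun m => by
    induction m with
    | zero => rfl
    | succ m ih =>
      rw [← ih, div_eq_div_iff (hgne _ (by omega)) (hgne _ (by omega))]
      have := wronskian_eq hfs hgs (N + m)
      rw [hw] at this
      have := (mul_eq_zero.1 this).resolve_left (Complex.ofReal_ne_zero.2 (J.a_pos _).ne')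
      rw [← add_assoc]
      linear_combination -this
  have hlim : f N z / g N z = 1 := by
    have h1 : Filter.Tendsto (fun m => p (m + N) / q (m + N)) Filter.atTop (nhds (1 / 1)) :=
      (hp1.comp (Filter.tendsto_add_atTop_nat N)).div
        (hq1.comp (Filter.tendsto_add_atTop_nat N)) one_ne_zero
    have h2 : ∀ m, p (m + N) / q (m + N) = f N z / g N z := fun m => by
      rw [← hratio m, hfp, hgq, mul_div_mul_left _ _ (pow_ne_zero _ hz0), add_comm]
    simp only [h2, div_one] at h1
    exact tendsto_nhds_unique tendsto_const_nhds h1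
  have hfin : ∀ m, f (N + m) z - g (N + m) z = 0 := fun m => by
    have := hratio m
    rw [hlim, div_eq_one_iff_eq (hgne _ (by omega))] at this
    rw [this, sub_self]
  rw [← sub_eq_zero]
  exact (hfs.sub hgs).eq_zero_of_le (N + n) (hfin n) (hfin (n + 1)) n (by omega)

theorem JostKernel.jostFunction_eq {J : JacobiMatrix} (K : J.JostKernel) {z : ℂ} (hz0 : z ≠ 0)
    (hz : ‖z‖ ≤ 1) : J.jostFunction z = K.G 0 z / K.A 0 := by
  have h : J.IsJostSolution J.jostSolution :=
    Classical.epsilon_spec (p := J.IsJostSolution) ⟨_, K.isJostSolution_jost⟩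
  rw [jostFunction, h.eq K K.isJostSolution_jost hz0 hz]
  simp [JostKernel.jost]

end JacobiMatrix

/-! ### Eigenvalues and zeros of the Jost function -/

namespace JacobiMatrix

open scoped InnerProductSpace

/-- Green's identity for the partial sums of `⟪J x, y⟫ - ⟪x, J y⟫`. -/
theorem green_identity (J : JacobiMatrix) (x y : ℕ → ℂ) (N : ℕ) :
    ∑ k ∈ Finset.range (N + 1), (J.entry y k * (starRingEnd ℂ) (x k) -
      y k * (starRingEnd ℂ) (J.entry x k)) =
      J.a (N + 1) * (y (N + 1) * (starRingEnd ℂ) (x N) - y N * (starRingEnd ℂ) (x (N + 1))) := by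
  induction N with
  | zero =>
    simp [entry]
    ring
  | succ N ih =>
    rw [Finset.sum_range_succ, ih]
    simp [entry]
    ring

/-- The boundary term in Green's identity tends to 0, since the entries of `J` are bounded and ℓ²
sequences tend to 0. -/
theorem isSymmetric_operator (J : JacobiMatrix) : J.operator.IsSymmetric := by
  intro x y
  have h1 := lp.hasSum_inner (𝕜 := ℂ) (J.operator x) y
  have h2 := lp.hasSum_inner (𝕜 := ℂ) x (J.operator y)
  have h3 := ((h2.sub h1).tendsto_sum_nat).comp (Filter.tendsto_add_atTop_nat 1)
  obtain ⟨M, hM⟩ := J.bdd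
  have hlim : ∀ u : lp (fun _ : ℕ => ℂ) 2, Filter.Tendsto (fun n => ‖u n‖) Filter.atTop (nhds 0) :=
    fun u => by
      have hu : Summable fun k => ‖u k‖ ^ (2 : ℝ) := by
        simpa using (memℓp_gen_iff (by norm_num)).1 (lp.memℓp u)
      have := hu.tendsto_atTop_zero.sqrt
      simpa [Real.rpow_two, Real.sqrt_sq] using this
  have hsh := Filter.tendsto_add_atTop_nat 1
  have h4 : Filter.Tendsto (fun N => M * (‖y (N + 1)‖ * ‖x N‖ + ‖y N‖ * ‖x (N + 1)‖)) Filter.atTop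
      (nhds 0) := by
    have := ((((hlim y).comp hsh).mul (hlim x)).add ((hlim y).mul ((hlim x).comp hsh))).const_mul M
    simpa using this
  have h5 := squeeze_zero_norm (f := fun N => ∑ k ∈ Finset.range (N + 1),
    (⟪x k, J.operator y k⟫_ℂ - ⟪J.operator x k, y k⟫_ℂ)) (fun N => by
      have := green_identity J x y N
      change ‖∑ k ∈ Finset.range (N + 1), (J.entry y k * (starRingEnd ℂ) (x k) -
        y k * (starRingEnd ℂ) (J.entry x k))‖ ≤ M * (‖y (N + 1)‖ * ‖x N‖ + ‖y N‖ * ‖x (N + 1)‖)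
      rw [this, norm_mul, Complex.norm_real, Real.norm_eq_abs]
      refine mul_le_mul (hM _).1 ?_ (norm_nonneg _) ((abs_nonneg _).trans (hM 0).1)
      refine (norm_sub_le _ _).trans (le_of_eq ?_)
      simp) h4
  exact (sub_eq_zero.1 (tendsto_nhds_unique h3 h5)).symm

/-- A solution of the eigenvalue equation is determined by its first entry. -/
theorem eq_zero_of_operator_eq (J : JacobiMatrix) {μ : ℂ} {y : lp (fun _ : ℕ => ℂ) 2}
    (hy : J.operator y = μ • y) (h0 : y 0 = 0) : y = 0 := by
  have hk : ∀ k, J.entry y k = μ * y k := fun k =>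
    congrArg (fun u : lp (fun _ : ℕ => ℂ) 2 => u k) hy
  have ha : ∀ n, (J.a n : ℂ) ≠ 0 := fun n => Complex.ofReal_ne_zero.2 (J.a_pos n).ne'
  have key : ∀ n, y n = 0 ∧ y (n + 1) = 0 := by
    intro n
    induction n with
    | zero =>
      have := hk 0
      simp only [entry, h0, mul_zero, zero_add] at this
      exact ⟨h0, (mul_eq_zero.1 this).resolve_left (ha 1)⟩
    | succ n ih =>
      have := hk (n + 1)
      simp only [entry, ih.1, ih.2, mul_zero, zero_add] at this
      exact ⟨ih.2, (mul_eq_zero.1 this).resolve_left (ha _)⟩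
  ext n
  exact (key n).1

theorem finiteDimensional_eigenspace (J : JacobiMatrix) (μ : ℂ) :
    FiniteDimensional ℂ (J.operator.eigenspace μ) := by
  let φ : J.operator.eigenspace μ →ₗ[ℂ] ℂ :=
    { toFun := fun y => (y : lp (fun _ : ℕ => ℂ) 2) 0
      map_add' := fun x y => by simp
      map_smul' := fun c x => by simp }
  refine FiniteDimensional.of_injective φ ((injective_iff_map_eq_zero φ).2 fun y hy => ?_)
  exact Subtype.ext (J.eq_zero_of_operator_eq (Module.End.mem_eigenspace_iff.1 y.2) hy)

/-- Finite algebraic multiplicity is automatic: symmetry excludes generalized eigenvectors, and an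
eigenvector is determined by its first entry. -/
theorem mem_discreteSpectrum_of_hasEigenvalue (J : JacobiMatrix) {μ : ℂ}
    (hμ : μ ∉ ((↑) : ℝ → ℂ) '' Set.Icc (-1) 1) (h : J.operator.HasEigenvalue μ) :
    μ ∈ J.discreteSpectrum := by
  refine ⟨hμ, h, ?_⟩
  rw [J.isSymmetric_operator.isFinitelySemisimple.maxGenEigenspace_eq_eigenspace]
  exact J.finiteDimensional_eigenspace μ

/-- The Joukowski map takes no value in `[-1, 1]` on the punctured open disk. -/
theorem joukowski_notMem {z : ℂ} (hz0 : z ≠ 0) (hz : ‖z‖ < 1) :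
    (z + z⁻¹) / 2 ∉ ((↑) : ℝ → ℂ) '' Set.Icc (-1) 1 := by
  rintro ⟨t, ⟨ht1, ht2⟩, ht⟩
  have h1 : z ^ 2 + 1 = 2 * t * z := by
    rw [ht]
    field_simp
  have hs : (0 : ℝ) ≤ 1 - t ^ 2 := by nlinarith
  -- The roots of `z² - 2 t z + 1` are `t ± i √(1 - t²)`, both of modulus 1.
  have h2 : (z - t - Real.sqrt (1 - t ^ 2) * Complex.I) *
      (z - t + Real.sqrt (1 - t ^ 2) * Complex.I) = 0 := by
    have h3 : ((Real.sqrt (1 - t ^ 2) : ℝ) : ℂ) ^ 2 = 1 - (t : ℂ) ^ 2 := by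
      rw [← Complex.ofReal_pow, Real.sq_sqrt hs]
      push_cast
      ring
    linear_combination h1 + h3 - (Real.sqrt (1 - t ^ 2) : ℂ) ^ 2 * Complex.I_sq
  have h4 : Complex.normSq z = 1 := by
    rcases mul_eq_zero.1 h2 with h | h
    · rw [show z = t + Real.sqrt (1 - t ^ 2) * Complex.I by linear_combination h,
        Complex.normSq_add_mul_I, Real.sq_sqrt hs]
      ring
    · rw [show z = t + (-Real.sqrt (1 - t ^ 2) : ℝ) * Complex.I by
          push_cast
          linear_combination h,
        Complex.normSq_add_mul_I, neg_sq, Real.sq_sqrt hs]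
      ring
  rw [Complex.normSq_eq_norm_sq] at h4
  nlinarith [norm_nonneg z]

namespace JostKernel

variable {J : JacobiMatrix} (K : J.JostKernel)

theorem jost_tendsto_factor {z : ℂ} (hz : ‖z‖ ≤ 1) :
    Filter.Tendsto (fun n => K.G n z / K.A n) Filter.atTop (nhds 1) :=
  K.tendstoUniformlyOn_jost.tendsto_at hz

theorem jost_ne_zero_eventually {z : ℂ} (hz0 : z ≠ 0) (hz : ‖z‖ ≤ 1) :
    ∀ᶠ n in Filter.atTop, K.jost n z ≠ 0 := by
  filter_upwards [(K.jost_tendsto_factor hz).eventually_ne one_ne_zero] with n hn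
  exact mul_ne_zero (pow_ne_zero _ hz0) hn

theorem memℓp_jost {z : ℂ} (hz : ‖z‖ < 1) : Memℓp (fun k => K.jost (k + 1) z) 2 := by
  obtain ⟨C, hC⟩ := (K.jost_tendsto_factor hz.le).norm.bddAbove_range
  have hC' : ∀ n, ‖K.G n z / K.A n‖ ≤ C := fun n => hC ⟨n, rfl⟩
  refine (memℓp_gen_iff (by norm_num)).2 ?_
  have hg : Summable fun k : ℕ => C ^ 2 * (‖z‖ ^ 2) ^ k :=
    (summable_geometric_of_lt_one (by positivity) (pow_lt_one₀ (norm_nonneg _) hz two_ne_zero)).mul_left _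
  refine Summable.of_nonneg_of_le (fun k => by positivity) (fun k => ?_) hg
  simp only [ENNReal.toReal_ofNat, Real.rpow_two]
  have h1 : ‖K.jost (k + 1) z‖ ≤ C * ‖z‖ ^ k := by
    rw [jost, norm_mul, norm_pow, mul_comm]
    exact mul_le_mul (hC' _) (pow_le_pow_of_le_one (norm_nonneg _) hz.le (Nat.le_succ k))
      (by positivity) ((norm_nonneg _).trans (hC' 0))
  calc ‖K.jost (k + 1) z‖ ^ 2 ≤ (C * ‖z‖ ^ k) ^ 2 := by gcongr
    _ = _ := by ring

/-- The geometrically decaying sequence `f 1, f 2, …` is an eigenvector: `f 0 = 0` is exactly what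
the first row of the matrix requires. -/
theorem mem_discreteSpectrum_of_eq_zero {z : ℂ} (hz0 : z ≠ 0) (hz : ‖z‖ < 1)
    (h : K.jost 0 z = 0) : (z + z⁻¹) / 2 ∈ J.discreteSpectrum := by
  refine J.mem_discreteSpectrum_of_hasEigenvalue (joukowski_notMem hz0 hz) ?_
  have hrec := K.solves_jost hz0 hz.le
  refine Module.End.hasEigenvalue_of_hasEigenvector
    (x := (⟨fun k => K.jost (k + 1) z, K.memℓp_jost hz⟩ : lp (fun _ : ℕ => ℂ) 2)) ⟨?_, ?_⟩
  · rw [Module.End.mem_eigenspace_iff]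
    ext k
    change J.entry (fun k => K.jost (k + 1) z) k = (z + z⁻¹) / 2 * K.jost (k + 1) z
    cases k with
    | zero =>
      have := hrec 0
      simp only [h, mul_zero, zero_add] at this
      simpa [entry] using this
    | succ k => exact hrec (k + 1)
  · intro h0
    obtain ⟨N, hN⟩ := Filter.eventually_atTop.1 (K.jost_ne_zero_eventually hz0 hz.le)
    exact hN (N + 1) (by omega) (congrArg (fun u : lp (fun _ : ℕ => ℂ) 2 => u N) h0)

theorem conj_G (n : ℕ) (z : ℂ) : (starRingEnd ℂ) (K.G n z) = K.G n ((starRingEnd ℂ) z) := by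
  rw [G, symbol, Complex.conj_tsum, G, symbol]
  simp

theorem conj_eq_inv {z : ℂ} (hz : ‖z‖ = 1) : (starRingEnd ℂ) z = z⁻¹ := by
  rw [Complex.inv_def, Complex.normSq_eq_norm_sq, hz]
  simp

theorem conj_jost (n : ℕ) {z : ℂ} (hz : ‖z‖ = 1) :
    (starRingEnd ℂ) (K.jost n z) = K.jost n z⁻¹ := by
  rw [jost, map_mul, map_div₀, map_pow, conj_G, Complex.conj_ofReal, conj_eq_inv hz, jost]

/-- The Wronskian of the Jost solution and its conjugate on the unit circle. -/
theorem jost_wronskian {z : ℂ} (hz : ‖z‖ = 1) :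
    K.jost 0 z * K.jost 1 z⁻¹ - K.jost 1 z * K.jost 0 z⁻¹ = (z⁻¹ - z) / 2 := by
  have hz0 : z ≠ 0 := norm_ne_zero_iff.1 (by rw [hz]; exact one_ne_zero)
  have hz' : ‖z⁻¹‖ = 1 := by rw [norm_inv, hz, inv_one]
  have h1 := K.solves_jost hz0 hz.le
  have h2 := K.solves_jost (inv_ne_zero hz0) hz'.le
  rw [inv_inv, add_comm z⁻¹] at h2
  have p1 := K.jost_tendsto_factor hz.le
  have q1 := K.jost_tendsto_factor hz'.le
  have hsh := Filter.tendsto_add_atTop_nat 1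
  have hlim := K.tendsto_a.mul (((p1.mul (q1.comp hsh)).const_mul z⁻¹).sub
    (((p1.comp hsh).mul q1).const_mul z))
  have hw := wronskian_eq h1 h2
  have hc : ∀ n, (J.a n : ℂ) * (z⁻¹ * (K.G n z / K.A n * (K.G (n + 1) z⁻¹ / K.A (n + 1))) -
      z * (K.G (n + 1) z / K.A (n + 1) * (K.G n z⁻¹ / K.A n))) =
      K.jost 0 z * K.jost 1 z⁻¹ - K.jost 1 z * K.jost 0 z⁻¹ := fun n => by
    rw [← hw n]
    simp only [jost]
    have hzz : z ^ n * z⁻¹ ^ n = 1 := by rw [← mul_pow, mul_inv_cancel₀ hz0, one_pow]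
    rw [pow_succ, pow_succ]
    linear_combination -((J.a n : ℂ) * (z⁻¹ * (K.G n z / K.A n * (K.G (n + 1) z⁻¹ / K.A (n + 1))) -
      z * (K.G (n + 1) z / K.A (n + 1) * (K.G n z⁻¹ / K.A n)))) * hzz
  have hlim' := hlim.congr hc
  rw [tendsto_nhds_unique tendsto_const_nhds hlim']
  ring

/-- Without discrete spectrum and resonances the Jost function has no zeros in the closed disk. -/
theorem G_zero_ne_zero (hd : J.discreteSpectrum = ∅) (hr : J.NoResonance) {z : ℂ} (hz : ‖z‖ ≤ 1) :
    K.G 0 z ≠ 0 := by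
  intro h
  have hj : K.jost 0 z = 0 := by simp [jost, h]
  by_cases hz0 : z = 0
  · rw [hz0, G, symbol_zero, K.g_zero] at h
    simp at h
  rcases hz.lt_or_eq with hlt | heq
  · have := K.mem_discreteSpectrum_of_eq_zero hz0 hlt hj
    rw [hd] at this
    exact this
  -- The coefficients are real, so a zero at `z` on the circle is also one at `z⁻¹`. The Wronskian
  -- then vanishes, leaving only `z = ±1`, the resonances.
  · have hw := K.jost_wronskian heq
    rw [← K.conj_jost 0 heq, hj, map_zero, zero_mul, mul_zero, sub_zero, eq_comm,
      div_eq_zero_iff, or_iff_left two_ne_zero, sub_eq_zero] at hw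
    have h2 : z ^ 2 = 1 := by
      rw [pow_two]
      nth_rewrite 1 [← hw]
      exact inv_mul_cancel₀ hz0
    rcases sq_eq_one_iff.1 h2 with rfl | rfl
    · exact hr.1 (by rw [K.jostFunction_eq hz0 hz, h, zero_div])
    · exact hr.2 (by rw [K.jostFunction_eq hz0 hz, h, zero_div])

end JostKernel

end JacobiMatrix

/-! ### Fourier coefficients as circle averages -/

section CircleAverages

open Metric

theorem circleAverage_pow_of_pos {k : ℕ} (hk : k ≠ 0) :
    Real.circleAverage (fun z : ℂ => z ^ k) 0 1 = 0 := by
  have h : DiffContOnCl ℂ (fun z : ℂ => z ^ k) (ball 0 |1|) :=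
    (differentiable_id.pow k).diffContOnCl
  rw [h.circleAverage, zero_pow hk]

theorem circleAverage_inv_pow_mul_pow (m l : ℕ) :
    Real.circleAverage (fun z : ℂ => z⁻¹ ^ m * z ^ l) 0 1 = if l = m then 1 else 0 := by
  have hne : ∀ z ∈ sphere (0 : ℂ) |1|, z ≠ 0 := fun z hz => by
    rintro rfl
    simp at hz
  rcases lt_trichotomy l m with h | rfl | h
  · obtain ⟨i, rfl⟩ := Nat.exists_eq_add_of_lt h
    rw [if_neg (by omega)]
    have e : Set.EqOn (fun z : ℂ => z⁻¹ ^ (l + i + 1) * z ^ l) (fun z => z⁻¹ ^ (i + 1))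
        (sphere 0 |1|) := fun z hz => by
      have h1 : z⁻¹ ^ l * z ^ l = 1 := by rw [← mul_pow, inv_mul_cancel₀ (hne z hz), one_pow]
      simp only
      linear_combination z⁻¹ ^ (i + 1) * h1
    rw [Real.circleAverage_congr_sphere e,
      Real.circleAverage_zero_one_congr_inv (f := fun z : ℂ => z ^ (i + 1)),
      circleAverage_pow_of_pos (Nat.succ_ne_zero i)]
  · have e : Set.EqOn (fun z : ℂ => z⁻¹ ^ l * z ^ l) (fun _ => 1) (sphere 0 |1|) := fun z hz => by
      simp only
      rw [← mul_pow, inv_mul_cancel₀ (hne z hz), one_pow]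
    rw [Real.circleAverage_congr_sphere e, Real.circleAverage_const, if_pos rfl]
  · obtain ⟨i, rfl⟩ := Nat.exists_eq_add_of_lt h
    rw [if_neg (by omega)]
    have e : Set.EqOn (fun z : ℂ => z⁻¹ ^ m * z ^ (m + i + 1)) (fun z => z ^ (i + 1))
        (sphere 0 |1|) := fun z hz => by
      have h1 : z⁻¹ ^ m * z ^ m = 1 := by rw [← mul_pow, inv_mul_cancel₀ (hne z hz), one_pow]
      simp only
      linear_combination z ^ (i + 1) * h1
    rw [Real.circleAverage_congr_sphere e, circleAverage_pow_of_pos (Nat.succ_ne_zero i)]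

/-- Termwise averaging of a product with an absolutely convergent power series. -/
theorem hasSum_circleAverage_mul_symbol {h : ℂ → ℂ} (hh : ContinuousOn h (sphere 0 1))
    (x : SummableSeq) :
    HasSum (fun l : ℕ => (x l : ℂ) * Real.circleAverage (fun z => h z * z ^ l) 0 1)
      (Real.circleAverage (fun z => h z * symbol x z) 0 1) := by
  obtain ⟨C, hC⟩ := (isCompact_sphere (0 : ℂ) 1).exists_bound_of_continuousOn hh
  have hmem : ∀ θ, circleMap 0 1 θ ∈ sphere (0 : ℂ) 1 := fun θ => by simp
  have hnorm : ∀ θ, ‖circleMap 0 1 θ‖ ≤ 1 := fun θ => by simp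
  have hcont : Continuous fun θ => h (circleMap 0 1 θ) :=
    hh.comp_continuous (continuous_circleMap 0 1) hmem
  have key : HasSum (fun l : ℕ => ∫ θ in (0 : ℝ)..2 * Real.pi,
      h (circleMap 0 1 θ) * ((x l : ℂ) * circleMap 0 1 θ ^ l))
      (∫ θ in (0 : ℝ)..2 * Real.pi, h (circleMap 0 1 θ) * symbol x (circleMap 0 1 θ)) := by
    refine intervalIntegral.hasSum_integral_of_dominated_convergence (fun l _ => C * ‖x l‖)
      (fun l => ?_) (fun l => ?_) ?_ ?_ ?_
    · exact (hcont.mul (continuous_const.mul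
        ((continuous_circleMap 0 1).pow l))).aestronglyMeasurable
    · refine Filter.Eventually.of_forall fun θ _ => ?_
      rw [norm_mul]
      exact mul_le_mul (hC _ (hmem θ)) (norm_symbol_term_le x (hnorm θ) l) (norm_nonneg _)
        ((norm_nonneg _).trans (hC _ (hmem θ)))
    · exact Filter.Eventually.of_forall fun θ _ => (summable_norm_summableSeq x).mul_left C
    · exact intervalIntegrable_const
    · exact Filter.Eventually.of_forall fun θ _ => ((summable_symbol x (hnorm θ)).hasSum).mul_left _
  refine (key.const_smul (2 * Real.pi)⁻¹).congr_fun fun l => ?_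
  rw [Real.circleAverage_def, mul_smul_comm, ← intervalIntegral.integral_const_mul]
  congr 2
  ext θ
  ring

end CircleAverages

/-! ### Derivation of the Marchenko equation -/

namespace JacobiMatrix

open Metric

theorem scatteringCoeff_eq_circleAverage (J : JacobiMatrix) (n : ℕ) :
    J.scatteringCoeff n = -Real.circleAverage (fun z => J.scatteringFunction z * z ^ n) 0 1 := by
  have hper : Function.Periodic (fun θ : ℝ => J.scatteringFunction (circleMap 0 1 θ) *
      circleMap 0 1 θ ^ n) (2 * Real.pi) := fun θ => by
    simp only [periodic_circleMap 0 1 θ]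
  have h := hper.intervalIntegral_add_eq 0 (-Real.pi)
  rw [zero_add, show -Real.pi + 2 * Real.pi = Real.pi by ring] at h
  rw [Real.circleAverage_def, h, scatteringCoeff, neg_mul]
  congr 1
  rw [Complex.real_smul]
  congr 1
  · push_cast
    rw [one_div]
  · congr 1
    ext θ
    rw [circleMap_zero, Complex.ofReal_one, one_mul, ← Complex.exp_nat_mul]
    congr 2
    push_cast
    ring

/-- Riemann–Lebesgue, applied to the scattering function cut off to one period, at the frequencies
`-n / (2π)`. -/
theorem tendsto_scatteringCoeff (J : JacobiMatrix) :
    Filter.Tendsto (fun n : ℕ => J.scatteringCoeff n) Filter.atTop (nhds 0) := by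
  set f : ℝ → ℂ := (Set.Ioc (-Real.pi) Real.pi).indicator fun θ : ℝ =>
    J.scatteringFunction (Complex.exp (θ * Complex.I)) with hf
  have h := Real.tendsto_integral_exp_smul_cocompact f
  have hw : Filter.Tendsto (fun n : ℕ => -((n : ℝ) * (2 * Real.pi)⁻¹)) Filter.atTop
      (Filter.cocompact ℝ) := by
    refine Filter.Tendsto.mono_right ?_ atBot_le_cocompact
    exact Filter.tendsto_neg_atTop_atBot.comp
      (tendsto_natCast_atTop_atTop.atTop_mul_const (by positivity))
  have h2 := (h.comp hw).const_mul (-(1 / (2 * (Real.pi : ℂ))))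
  rw [mul_zero] at h2
  refine h2.congr fun n => ?_
  rw [scatteringCoeff, Function.comp]
  congr 1
  rw [intervalIntegral.integral_of_le (by linarith [Real.pi_pos]),
    ← MeasureTheory.integral_indicator measurableSet_Ioc]
  congr 1
  ext θ
  by_cases hθ : θ ∈ Set.Ioc (-Real.pi) Real.pi
  · rw [hf, Set.indicator_of_mem hθ, Set.indicator_of_mem hθ, Circle.smul_def, Real.fourierChar_apply,
      smul_eq_mul, mul_comm]
    congr 2
    have : (Real.pi : ℂ) ≠ 0 := Complex.ofReal_ne_zero.2 Real.pi_ne_zero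
    push_cast
    field_simp
  · rw [hf, Set.indicator_of_notMem hθ, Set.indicator_of_notMem hθ, smul_zero]

namespace JostKernel

variable {J : JacobiMatrix} (K : J.JostKernel)

/-- The polynomials `z ^ n (f n z * conj (f 0 z) - conj (f n z) * f 0 z)`. -/
noncomputable def wronskianPoly (J : JacobiMatrix) : ℕ → ℂ → ℂ
  | 0 => fun _ => 0
  | 1 => fun z => (z ^ 2 - 1) / 2
  | n + 2 => fun z => ((z ^ 2 + 1) / 2 * wronskianPoly J (n + 1) z -
      J.a n * z ^ 2 * wronskianPoly J n z - J.b (n + 1) * z * wronskianPoly J (n + 1) z) /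
        J.a (n + 1)

theorem differentiable_wronskianPoly (J : JacobiMatrix) (n : ℕ) :
    Differentiable ℂ (wronskianPoly J n) := by
  induction n using Nat.twoStepInduction with
  | zero => exact differentiable_const 0
  | one =>
    unfold wronskianPoly
    fun_prop
  | more n h1 h2 =>
    unfold wronskianPoly
    fun_prop

/-- At `z = 0` the recursion reduces to division by `2 * a (n + 1)`, which is also the step from `A
(n + 1)` to `A (n + 2)`. -/
theorem wronskianPoly_zero (n : ℕ) : wronskianPoly J (n + 1) 0 * K.A 0 = -K.A (n + 1) := by
  induction n with
  | zero =>
    simp only [wronskianPoly, K.A_eq 0, J.a_zero]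
    push_cast
    ring
  | succ n ih =>
    have h : (J.a (n + 1) : ℂ) ≠ 0 := Complex.ofReal_ne_zero.2 (J.a_pos _).ne'
    rw [K.A_eq (n + 1)] at ih
    simp only [wronskianPoly]
    push_cast at ih
    field_simp
    linear_combination ih

/-- In `n` the bracket is a combination of two solutions, so it is fixed by its first two values, 0
and the known Wronskian. The resulting polynomial extends into the disk, where `jost n z⁻¹` need not
make sense. -/
theorem wronskianPoly_eq (n : ℕ) {z : ℂ} (hz : ‖z‖ = 1) :
    z ^ n * (K.jost n z * K.jost 0 z⁻¹ - K.jost n z⁻¹ * K.jost 0 z) = wronskianPoly J n z := by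
  have hz0 : z ≠ 0 := norm_ne_zero_iff.1 (by rw [hz]; exact one_ne_zero)
  have hz' : ‖z⁻¹‖ = 1 := by rw [norm_inv, hz, inv_one]
  have h1 := K.solves_jost hz0 hz.le
  have h2 := K.solves_jost (inv_ne_zero hz0) hz'.le
  rw [inv_inv, add_comm z⁻¹] at h2
  induction n using Nat.twoStepInduction with
  | zero =>
    simp only [wronskianPoly]
    ring
  | one =>
    have := K.jost_wronskian hz
    simp only [wronskianPoly]
    rw [show K.jost 1 z * K.jost 0 z⁻¹ - K.jost 1 z⁻¹ * K.jost 0 z = -((z⁻¹ - z) / 2) by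
      rw [← this]; ring]
    field_simp
    ring
  | more n e1 e2 =>
    have h : (J.a (n + 1) : ℂ) ≠ 0 := Complex.ofReal_ne_zero.2 (J.a_pos _).ne'
    have r1 := h1 n
    have r2 := h2 n
    simp only [wronskianPoly]
    rw [eq_div_iff h, ← e1, ← e2]
    have hzz : z * z⁻¹ = 1 := mul_inv_cancel₀ hz0
    linear_combination z ^ (n + 2) * (K.jost 0 z⁻¹ * r1 - K.jost 0 z * r2) + z ^ (n + 1) *
      (K.jost (n + 1) z * K.jost 0 z⁻¹ - K.jost (n + 1) z⁻¹ * K.jost 0 z) / 2 * hzz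

theorem continuousOn_G (n : ℕ) : ContinuousOn (K.G n) (closedBall 0 1) :=
  continuousOn_symbol _

theorem scatteringFunction_eq {z : ℂ} (hz : ‖z‖ = 1) :
    J.scatteringFunction z = K.G 0 z⁻¹ / K.G 0 z := by
  have hz0 : z ≠ 0 := norm_ne_zero_iff.1 (by rw [hz]; exact one_ne_zero)
  rw [scatteringFunction, K.jostFunction_eq hz0 hz.le, map_div₀, conj_G, conj_eq_inv hz,
    Complex.conj_ofReal, div_div_div_cancel_right₀ (K.A_ne 0)]

theorem continuousOn_G_inv (n : ℕ) : ContinuousOn (fun z => K.G n z⁻¹) (sphere 0 1) := by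
  refine (K.continuousOn_G n).comp (continuousOn_inv₀.mono fun z hz => ?_) fun z hz => ?_
  · rintro rfl
    simp at hz
  · rw [mem_sphere_zero_iff_norm] at hz
    simp [hz]

theorem continuousOn_scatteringFunction (K : J.JostKernel) (hd : J.discreteSpectrum = ∅) (hr : J.NoResonance) :
    ContinuousOn J.scatteringFunction (sphere 0 1) := by
  have h : ContinuousOn (fun z => K.G 0 z⁻¹ / K.G 0 z) (sphere 0 1) :=
    (K.continuousOn_G_inv 0).div ((K.continuousOn_G 0).mono sphere_subset_closedBall)
      fun z hz => K.G_zero_ne_zero hd hr (mem_sphere_zero_iff_norm.1 hz).le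
  exact h.congr fun z hz => K.scatteringFunction_eq (mem_sphere_zero_iff_norm.1 hz)

/-- The scattering relation on the unit circle. -/
theorem scattering_relation (hd : J.discreteSpectrum = ∅) (hr : J.NoResonance) (n : ℕ) {z : ℂ}
    (hz : ‖z‖ = 1) :
    J.scatteringFunction z * z ^ (2 * n) * K.G n z - K.G n z⁻¹ =
      K.A n * K.A 0 * wronskianPoly J n z * (K.G 0 z)⁻¹ := by
  have hG := K.G_zero_ne_zero hd hr hz.le
  have hz0 : z ≠ 0 := norm_ne_zero_iff.1 (by rw [hz]; exact one_ne_zero)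
  rw [← K.wronskianPoly_eq n hz, K.scatteringFunction_eq hz]
  have h1 := K.A_ne n
  have h2 := K.A_ne 0
  simp only [jost, inv_pow, pow_zero, one_mul]
  field_simp
  ring

theorem circleAverage_G_inv (n m : ℕ) :
    Real.circleAverage (fun z => K.G n z⁻¹ * z ^ m) 0 1 = K.g n m := by
  have e : Real.circleAverage (fun z => K.G n z⁻¹ * z ^ m) 0 1 =
      Real.circleAverage (fun z => z⁻¹ ^ m * symbol (K.g n) z) 0 1 := by
    rw [← Real.circleAverage_zero_one_congr_inv (f := fun z => z⁻¹ ^ m * symbol (K.g n) z)]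
    congr 1
    ext z
    rw [inv_inv, mul_comm]
    rfl
  have hc : ContinuousOn (fun z : ℂ => z⁻¹ ^ m) (sphere 0 1) :=
    (continuousOn_inv₀.mono fun z hz => by
      rintro rfl
      simp at hz).pow m
  have h := hasSum_circleAverage_mul_symbol hc (K.g n)
  simp only [circleAverage_inv_pow_mul_pow] at h
  rw [e, ← h.tsum_eq, tsum_eq_single m (fun l hl => by simp [hl])]
  simp

theorem diffContOnCl_inv_G (hd : J.discreteSpectrum = ∅) (hr : J.NoResonance) :
    DiffContOnCl ℂ (fun z => (K.G 0 z)⁻¹) (ball 0 1) := by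
  refine (diffContOnCl_symbol (K.g 0)).inv fun z hz => K.G_zero_ne_zero hd hr ?_
  rw [closure_ball _ one_ne_zero] at hz
  simpa using hz

/-- The Marchenko equation in Fourier form. -/
theorem marchenko_average (hd : J.discreteSpectrum = ∅) (hr : J.NoResonance) (n m : ℕ) :
    (∑' l, (K.g n l : ℂ) * -J.scatteringCoeff ((2 * n + m + l : ℕ) : ℤ)) - K.g n m =
      K.A n * K.A 0 * wronskianPoly J n 0 * 0 ^ m := by
  have hS := K.continuousOn_scatteringFunction hd hr
  have hsub := sphere_subset_closedBall (x := (0 : ℂ)) (ε := 1)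
  have c1 : ContinuousOn (fun z => J.scatteringFunction z * z ^ (2 * n + m)) (sphere 0 1) :=
    hS.mul (continuousOn_id.pow _)
  have c2 : ContinuousOn (fun z => J.scatteringFunction z * z ^ (2 * n + m) * symbol (K.g n) z)
      (sphere 0 1) := c1.mul ((K.continuousOn_G n).mono hsub)
  have c3 : ContinuousOn (fun z => K.G n z⁻¹ * z ^ m) (sphere 0 1) :=
    (K.continuousOn_G_inv n).mul (continuousOn_id.pow m)
  -- Since `G 0` has no zeros, the right side of the scattering relation times `z ^ m` is analytic
  -- in the disk, and its average is its value at 0, which vanishes for `m ≥ 1`.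
  have hR : DiffContOnCl ℂ (fun z => (K.A n * K.A 0 * wronskianPoly J n z * z ^ m) • (K.G 0 z)⁻¹)
      (ball 0 |1|) := by
    rw [abs_one]
    refine DiffContOnCl.smul (Differentiable.diffContOnCl ?_) (K.diffContOnCl_inv_G hd hr)
    exact ((differentiable_const _).mul (differentiable_wronskianPoly J n)).mul
      (differentiable_id.pow m)
  have h := hR.circleAverage
  have e : Set.EqOn (fun z => (K.A n * K.A 0 * wronskianPoly J n z * z ^ m) • (K.G 0 z)⁻¹)
      (fun z => J.scatteringFunction z * z ^ (2 * n + m) * symbol (K.g n) z - K.G n z⁻¹ * z ^ m)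
      (sphere 0 |1|) := fun z hz => by
    rw [abs_one, mem_sphere_zero_iff_norm] at hz
    have := K.scattering_relation hd hr n hz
    simp only [G, smul_eq_mul] at this ⊢
    rw [pow_add]
    linear_combination -z ^ m * this
  rw [Real.circleAverage_congr_sphere e,
    Real.circleAverage_fun_sub (c2.circleIntegrable zero_le_one) (c3.circleIntegrable zero_le_one),
    K.circleAverage_G_inv, ← (hasSum_circleAverage_mul_symbol c1 (K.g n)).tsum_eq] at h
  have hG0 : K.G 0 0 = 1 := by
    rw [G, symbol_zero, K.g_zero, Complex.ofReal_one]
  rw [hG0, inv_one, smul_eq_mul, mul_one] at h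
  rw [← h]
  congr 2
  ext l
  rw [scatteringCoeff_eq_circleAverage, neg_neg]
  congr 2
  ext z
  rw [pow_add z (2 * n + m) l, mul_assoc]

/-- The off-diagonal coefficients of the kernel. -/
noncomputable def offDiag (n l : ℕ) : ℂ := K.g n (l + 1)

theorem summable_norm_offDiag (n : ℕ) : Summable fun l => ‖K.offDiag n l‖ := by
  have := (summable_nat_add_iff 1).2 (summable_norm_summableSeq (K.g n))
  simpa [offDiag] using this

theorem marchenko_tsum (hF : Summable fun n : ℕ => ‖J.scatteringCoeff n‖) (n p : ℕ) :
    ∑' l, (K.g n l : ℂ) * -J.scatteringCoeff ((p + l : ℕ) : ℤ) =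
      -(J.scatteringCoeff p + ∑' l, J.scatteringCoeff ((p + 1 + l : ℕ) : ℤ) * K.offDiag n l) := by
  have hs : Summable fun l : ℕ => (K.g n l : ℂ) * -J.scatteringCoeff ((p + l : ℕ) : ℤ) := by
    have hk : Summable fun l => ‖(K.g n l : ℂ)‖ := by
      simpa using summable_norm_summableSeq (K.g n)
    refine ((summable_mul_of_summable_norm_shift (u := fun n : ℕ => J.scatteringCoeff n)
      hF hk p).of_norm.neg).congr fun l => ?_
    ring
  rw [hs.tsum_eq_zero_add, K.g_zero, add_zero, neg_add, ← tsum_neg]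
  congr 1
  · simp
  · congr 1
    ext l
    rw [offDiag, show p + (l + 1) = p + 1 + l by ring]
    ring

theorem marchenkoEq (hd : J.discreteSpectrum = ∅) (hr : J.NoResonance)
    (hF : Summable fun n : ℕ => ‖J.scatteringCoeff n‖) :
    MarchenkoEq (fun n : ℕ => J.scatteringCoeff n) K.offDiag := fun n m => by
  have h := K.marchenko_average hd hr n (m + 1)
  rw [K.marchenko_tsum hF, zero_pow (Nat.succ_ne_zero m), mul_zero] at h
  have e : K.offDiag n m = K.g n (m + 1) := rfl
  rw [← add_assoc] at h
  rw [e]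
  linear_combination -h

/-- The zeroth Fourier mode. For `n = 0` the formula fails: `wronskianPoly J 0 = 0`, so the diagonal
expression is 0 there. -/
theorem marchenkoDiag_eq (hd : J.discreteSpectrum = ∅) (hr : J.NoResonance)
    (hF : Summable fun n : ℕ => ‖J.scatteringCoeff n‖) {n : ℕ} (hn : 1 ≤ n) :
    marchenkoDiag (fun n : ℕ => J.scatteringCoeff n) K.offDiag n = (K.A n : ℂ) ^ 2 := by
  have h := K.marchenko_average hd hr n 0
  rw [K.marchenko_tsum hF, pow_zero, mul_one, K.g_zero, add_zero] at h
  obtain ⟨i, rfl⟩ := Nat.exists_eq_add_of_le' hn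
  have h2 := K.wronskianPoly_zero i
  rw [marchenkoDiag]
  push_cast at h ⊢
  linear_combination -h - K.A (i + 1) * h2

end JostKernel

end JacobiMatrix

theorem lemma4p2 (J : JacobiMatrix)
    (hmoment : J.HasFiniteFirstMoment)
    (hdiscrete : J.discreteSpectrum = ∅)
    (hresonance : J.NoResonance)
    (hF : Summable fun n : ℕ =>
      (n : ℝ) * ‖J.scatteringCoeff ((n : ℤ) + 2) - J.scatteringCoeff (n : ℤ)‖) :
    ∃ C : ℝ, ∀ n : ℕ, 1 ≤ n →
      |2 * J.a n - 1| + |J.b n| ≤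
        C * (‖J.scatteringCoeff (2 * (n : ℤ) - 1) - J.scatteringCoeff (2 * (n : ℤ) + 1)‖ +
          ‖J.scatteringCoeff (2 * (n : ℤ)) - J.scatteringCoeff (2 * (n : ℤ) + 2)‖ +
          J.tailSum (2 * (n : ℤ) - 2) ^ 2) := by
  obtain ⟨K⟩ := JacobiMatrix.nonempty_jostKernel hmoment
  set F : ℕ → ℂ := fun n => J.scatteringCoeff n with hFdef
  have hinc : Summable fun n : ℕ => (n : ℝ) * ‖F n - F (n + 2)‖ := by
    refine hF.congr fun n => ?_
    rw [norm_sub_rev]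
    simp [hFdef]
  have hd : Summable fun n => ‖F n - F (n + 2)‖ :=
    summable_of_summable_nat_mul (u := fun n => ‖F n - F (n + 2)‖) (fun _ => norm_nonneg _) hinc
  have h0 : Filter.Tendsto F Filter.atTop (nhds 0) := J.tendsto_scatteringCoeff
  -- `F` is dominated by its increment tails, and these are summable by the first moment hypothesis
  -- on the increments.
  have hFs : Summable fun n => ‖F n‖ :=
    Summable.of_nonneg_of_le (fun _ => norm_nonneg _) (norm_le_incrementTail hd h0)
      (summable_tails (u := fun n => ‖F n - F (n + 2)‖) (fun _ => norm_nonneg _) hinc)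
  obtain ⟨C, hC⟩ := exists_bound_of_marchenkoEq (b := J.b) hd hFs K.summable_norm_offDiag
    (K.marchenkoEq hdiscrete hresonance hFs) J.a_pos K.A_pos K.tendsto_A K.A_eq
    (fun n => by
      have := K.g_one_sub n
      rw [JacobiMatrix.JostKernel.offDiag, JacobiMatrix.JostKernel.offDiag]
      exact_mod_cast this)
    (fun n hn => K.marchenkoDiag_eq hdiscrete hresonance hFs hn)
  refine ⟨C, fun n hn => ?_⟩
  obtain ⟨i, rfl⟩ := Nat.exists_eq_add_of_le' hn
  refine (hC i).trans (le_of_eq ?_)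
  have e : incrementTail F (2 * i) = J.tailSum (2 * ((i + 1 : ℕ) : ℤ) - 2) := by
    rw [incrementTail, JacobiMatrix.tailSum]
    congr 1
    ext j
    simp only [hFdef]
    congr 3 <;> push_cast <;> ring
  rw [← e]
  simp only [hFdef]
  push_cast
  ring_nf
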